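/- **Model.** Let $n_1,n_2\ge 2$, $\delta\in(0,2)$ with $\delta\neq1$, $p\in(0,1/2)$, $\eta_1\in\{\pm1\}^{n_1}$, $\eta_2\in\{\pm1\}^{n_2}$. In the bipartite stochastic block model (BSBM) one observes a random matrix $A\in\{0,1\}^{n_1\times n_2}$ with independent entries such that $\mathbb P(A_{ij}=1)=\delta p$ if $\eta_{1i}=\eta_{2j}$ and $\mathbb P(A_{ij}=1)=(2-\delta)p$ if $\eta_{1i}\ne\eta_{2j}$. Let $n_{l\pm}$ be the number of entries of $\eta_l$ equal to $\pm1$ ($l=1,2$), and let $\gamma_1,\gamma_2\in(0,1)$ be bounds on the imbalances: $|n_{l+}-n_{l-}|/n_l\le\gamma_l$, $l=1,2$. **Estimator.** Put $\hat p=\frac1{n_1n_2}\sum_{i,j}A_{ij}$, $\hat A=A-\hat p\,\mathbf 1_{n_1}\mathbf 1_{n_2}^\top$, and $H(M)=M-\mathrm{diag}(M)$ for square $M$. Let $\eta_1^0=\mathrm{sign}(\hat v)\in\{\pm1\}^{n_1}$, where $\hat v$ is an eigenvector of $H(\hat A\hat A^\top)$ for its largest eigenvalue (any choice of $\hat v$,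 and any choice of the sign $\pm1$ at a zero entry of $\hat v$, is allowed). **Recovery.** For $\eta,\eta'\in\{\pm1\}^{n}$ let $r(\eta,\eta')=\min_{\nu\in\{-1,1\}}\sum_{i}|\eta'_i-\nu\eta_i|$. Consider any sequence of models with $n_1\to\infty$, where $n_2,\delta,p,\gamma_1,\gamma_2$ may vary along the sequence. An estimator $\hat\eta$ achieves weak recovery at level $\alpha\in(0,1)$ if $$\lim_{n_1\to\infty}\ \sup\ \mathbb P\Big(\frac{r(\eta_1,\hat\eta)}{n_1}\ge\alpha\Big)=0,$$ where the supremum is over all $\eta_1,\eta_2$ satisfying the two imbalance bounds; it achieves almost full recovery if this holds for every $\alpha\in(0,1)$. **Theorem 1.** (i) There is an absolute constant $C_0>0$ such that the following holds for all $\alpha\in(0,1)$ and all constants $C>C_0/\sqrt\alpha$. If, along the sequence, $$\gamma_1\gamma_2\le\frac{\sqrt\alpha}{96},\qquad p\ge C(\delta-1)^{-2}\left(\sqrt{\frac{\log n_1}{n_1n_2}}\vee\frac{\log n_1}{n_2}\right),$$ then $\eta_1^0$ achieves weak recovery at level $\alpha$. (ii) Let $(C_n)$ and $(C'_n)$ be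 sequences of positive numbers tending to infinity. If, along the sequence, $$\gamma_1\gamma_2\le\frac1{C'_{n_1}},\qquad p\ge C_{n_1}(\delta-1)^{-2}\left(\sqrt{\frac{\log n_1}{n_1n_2}}\vee\frac{\log n_1}{n_2}\right),$$ then $\eta_1^0$ achieves almost full recovery. -/

import Mathlib

open Filter Topology MeasureTheory ProbabilityTheory

namespace BSBM

noncomputable section

/-- A vector of community labels in `{±1}ⁿ`. -/
abbrev Labels (n : ℕ) : Type := Fin n → ℤˣ

/-- The value of a label as a real number `1` or `-1`. -/
def labelVal (u : ℤˣ) : ℝ := ((u : ℤ) : ℝ)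

/-- A bipartite graph on `V₁` (`n₁` vertices) and `V₂` (`n₂` vertices): `G (i, j)` says whether the
vertices `i ∈ V₁` and `j ∈ V₂` are connected. -/
abbrev BipGraph (n₁ n₂ : ℕ) : Type := Fin n₁ × Fin n₂ → Bool

/-- The biadjacency matrix, with entries in `{0, 1}`. -/
def biadj {n₁ n₂ : ℕ} (G : BipGraph n₁ n₂) : Matrix (Fin n₁) (Fin n₂) ℝ :=
  Matrix.of fun i j => if G (i, j) then 1 else 0

/-- Number of vertices with a given label. -/
def labelCount {n : ℕ} (η : Labels n) (u : ℤˣ) : ℕ := (Finset.univ.filter fun i => η i = u).card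

/-- The imbalance `|n₊ - n₋| / n` of a labelled vertex set. -/
def imbalance {n : ℕ} (η : Labels n) : ℝ :=
  |(labelCount η 1 : ℝ) - (labelCount η (-1) : ℝ)| / (n : ℝ)

/-- The Bernoulli law `Ber(q)` on `{true, false}`; it is used only for `q ∈ [0, 1]`
(other values of `q` are clamped to that interval). -/
def ber (q : ℝ) : Measure Bool :=
  bernoulliMeasure true false (Set.projIcc (0 : ℝ) 1 zero_le_one q)

/-- The law of the bipartite stochastic block model with labels `η₁`, `η₂`: the edges are
independent, with probability `δ p` between equal labels and `(2 - δ) p` between different ones. -/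
def law {n₁ n₂ : ℕ} (δ p : ℝ) (η₁ : Labels n₁) (η₂ : Labels n₂) : Measure (BipGraph n₁ n₂) :=
  Measure.pi fun ij => ber (if η₁ ij.1 = η₂ ij.2 then δ * p else (2 - δ) * p)

/-- An estimator of the labels of `V₁`: a function of the observed graph. (The space of graphs is
finite and discrete, so every function is measurable.) -/
abbrev Estimator (n₁ n₂ : ℕ) : Type := BipGraph n₁ n₂ → Labels n₁

/-- The loss `r(η, η') = min_{ν = ±1} ∑ᵢ |η'ᵢ - ν ηᵢ|`. -/
def loss {n : ℕ} (η η' : Labels n) : ℝ :=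
  min (∑ i, |labelVal (η' i) - labelVal (η i)|) (∑ i, |labelVal (η' i) + labelVal (η i)|)

/-- The estimator `p̂ = (n₁ n₂)⁻¹ 1ᵀ A 1` of the edge density. -/
def pHat {n₁ n₂ : ℕ} (A : Matrix (Fin n₁) (Fin n₂) ℝ) : ℝ :=
  (1 / ((n₁ : ℝ) * (n₂ : ℝ))) * ∑ i, ∑ j, A i j

/-- The corrected matrix `Â = A - p̂ 1 1ᵀ`. -/
def centered {n₁ n₂ : ℕ} (A : Matrix (Fin n₁) (Fin n₂) ℝ) : Matrix (Fin n₁) (Fin n₂) ℝ :=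
  A - Matrix.of fun _ _ => pHat A

/-- The hollowing operator `H(M) = M - diag(M)`. -/
def hollow {n : ℕ} (M : Matrix (Fin n) (Fin n) ℝ) : Matrix (Fin n) (Fin n) ℝ :=
  M - Matrix.diagonal M.diag

/-- The hollowed Gram matrix `H(Â Âᵀ)`. -/
def hollowedGram {n₁ n₂ : ℕ} (A : Matrix (Fin n₁) (Fin n₂) ℝ) : Matrix (Fin n₁) (Fin n₁) ℝ :=
  hollow (centered A * (centered A).transpose)

/-- `v` is a (nonzero) eigenvector of `M` for its largest eigenvalue. -/
def IsTopEigenvector {n : ℕ} (M : Matrix (Fin n) (Fin n) ℝ) (v : Fin n → ℝ) : Prop :=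
  ∃ μ : ℝ, Module.End.HasEigenvector (Matrix.toLin' M) μ v ∧
    ∀ μ' : ℝ, Module.End.HasEigenvalue (Matrix.toLin' M) μ' → μ' ≤ μ

/-- `e` is the spectral procedure on the hollowed matrix: `e = sign(v̂)` for a top eigenvector `v̂` of
`H(Â Âᵀ)`. Any choice of `v̂` (its sign; its direction if the top eigenvalue is multiple) and any
choice of a sign `±1` for a zero entry of `v̂` are allowed. -/
def IsSpectralEstimator {n₁ n₂ : ℕ} (e : Estimator n₁ n₂) : Prop :=
  ∀ G : BipGraph n₁ n₂, ∃ v : Fin n₁ → ℝ, IsTopEigenvector (hollowedGram (biadj G)) v ∧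
    ∀ i, v i ≠ 0 → labelVal (e G i) = Real.sign (v i)

/-- The standing assumptions on a sequence of models indexed by `k`, along which the size `n₁ k` of
`V₁` tends to infinity; `δ ≠ 1` is what makes `(δ - 1)⁻²` meaningful. -/
structure IsModelSequence (n₁ n₂ : ℕ → ℕ) (δ p γ₁ γ₂ : ℕ → ℝ) : Prop where
  n₁_tendsto : Tendsto n₁ atTop atTop
  two_le_n₁ : ∀ k, 2 ≤ n₁ k
  two_le_n₂ : ∀ k, 2 ≤ n₂ k
  δ_mem : ∀ k, δ k ∈ Set.Ioo (0 : ℝ) 2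
  δ_ne_one : ∀ k, δ k ≠ 1
  p_mem : ∀ k, p k ∈ Set.Ioo (0 : ℝ) (1 / 2)
  γ₁_mem : ∀ k, γ₁ k ∈ Set.Ioo (0 : ℝ) 1
  γ₂_mem : ∀ k, γ₂ k ∈ Set.Ioo (0 : ℝ) 1

/-- The largest probability, over all label vectors whose imbalances are at most `γ₁` and `γ₂`, that
the normalized loss `r(η₁, η̂) / n₁` is at least `α`. -/
def worstCaseFailure {n₁ n₂ : ℕ} (δ p γ₁ γ₂ α : ℝ) (e : Estimator n₁ n₂) : ENNReal :=
  ⨆ (η₁ : Labels n₁) (η₂ : Labels n₂) (_ : imbalance η₁ ≤ γ₁) (_ : imbalance η₂ ≤ γ₂),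
    law δ p η₁ η₂ {G | α ≤ loss η₁ (e G) / (n₁ : ℝ)}

/-- Weak recovery at level `α`. -/
def WeakRecoveryAt (α : ℝ) (n₁ n₂ : ℕ → ℕ) (δ p γ₁ γ₂ : ℕ → ℝ)
    (e : ∀ k, Estimator (n₁ k) (n₂ k)) : Prop :=
  Tendsto (fun k => worstCaseFailure (δ k) (p k) (γ₁ k) (γ₂ k) α (e k)) atTop (𝓝 0)

/-- Almost full recovery. -/
def AlmostFullRecovery (n₁ n₂ : ℕ → ℕ) (δ p γ₁ γ₂ : ℕ → ℝ)
    (e : ∀ k, Estimator (n₁ k) (n₂ k)) : Prop :=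
  ∀ α ∈ Set.Ioo (0 : ℝ) 1, WeakRecoveryAt α n₁ n₂ δ p γ₁ γ₂ e

/-- The rate `√(log n₁ / (n₁ n₂)) ∨ (log n₁ / n₂)`. -/
def rate (n₁ n₂ : ℕ) : ℝ :=
  max (Real.sqrt (Real.log (n₁ : ℝ) / ((n₁ : ℝ) * (n₂ : ℝ)))) (Real.log (n₁ : ℝ) / (n₂ : ℝ))

end

end BSBM

/-! Put s = (δ - 1) p and let W = A - 𝔼A. Since 𝔼A = p 1 1ᵀ + s η₁ η₂ᵀ, the hollowed Gram matrix
equals s² n₂ (η₁ η₁ᵀ - 1) plus a perturbation (`hollowedGram_eq`). The first part has top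
eigenvector η₁ and spectral gap s² n₁ n₂. By a Davis–Kahan argument (`loss_lt_of_formBound`), a
perturbation of size at most √α/4 times the gap leaves fewer than the allowed number of sign errors.

The perturbation has three sources, each allotted √α/12 of the gap. The hollowed noise H(W Wᵀ) has
size O(p n₁ n₂ · rate) with high probability, and comparison with the gap forces C to be of order
1/√α. The bias of p̂ caused by imbalance costs 8 γ₁ γ₂ times the gap, whence the 96. The terms
containing W η₂ and W 1 are controlled by second moments and Markov's inequality, and are o(1) times
the gap because (δ - 1)² p n₂ ≥ log n₁.

The noise bound is the main work. The columns w of W are independent and removing the diagonal makes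
each summand H(w wᵀ) centered, so the Ahlswede–Winter method applies; it rests on Golden–Thompson,
proved here from trace inequalities and the Lie product formula. The norm of a summand is only
bounded by |w|², which can be of order n₁ although it is typically of order p n₁, so a uniform bound
would be wasteful. Instead the factor exp(θ |w|²) is kept inside the expectation: it tilts the
product measure without destroying independence, and while θ p n₁ ≤ 1 the tilt costs only constants.
-/

namespace BSBM

open Matrix

/-! ### Trace inequalities for powers of products; orthogonal diagonalization -/

section MatrixExp

variable {n : Type*} [Fintype n]

theorem trace_mul_transpose_nonneg (X : Matrix n n ℝ) : 0 ≤ trace (X * Xᵀ) := by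
  simp only [trace, diag, mul_apply, transpose_apply]
  exact Finset.sum_nonneg fun i _ => Finset.sum_nonneg fun j _ => mul_self_nonneg _

/-- Cauchy–Schwarz for the trace inner product. -/
theorem trace_mul_sq_le (X Y : Matrix n n ℝ) :
    trace (X * Y) ^ 2 ≤ trace (X * Xᵀ) * trace (Y * Yᵀ) := by
  have h := Finset.sum_mul_sq_le_sq_mul_sq (Finset.univ : Finset (n × n))
    (fun ij => X ij.1 ij.2) (fun ij => Y ij.2 ij.1)
  have e1 : trace (X * Y) = ∑ ij : n × n, X ij.1 ij.2 * Y ij.2 ij.1 := by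
    simp [trace, mul_apply, Fintype.sum_prod_type]
  have e2 : trace (X * Xᵀ) = ∑ ij : n × n, X ij.1 ij.2 ^ 2 := by
    simp [trace, mul_apply, Fintype.sum_prod_type, sq]
  have e3 : trace (Y * Yᵀ) = ∑ ij : n × n, Y ij.2 ij.1 ^ 2 := by
    rw [Fintype.sum_prod_type, Finset.sum_comm]
    simp [trace, mul_apply, sq]
  rw [e1, e2, e3]
  exact h

theorem abs_trace_le_of_sq {X : Matrix n n ℝ} : |trace (X * X)| ≤ trace (X * Xᵀ) := by
  have h := trace_mul_sq_le X X
  rw [← sq (trace (X * Xᵀ))] at h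
  exact abs_le_of_sq_le_sq h (trace_mul_transpose_nonneg X)

variable [DecidableEq n]

/-- Orthogonal diagonalization of a real symmetric matrix. -/
theorem exists_orthogonal_diagonalization {A : Matrix n n ℝ} (hA : A.IsSymm) :
    ∃ (U : Matrix n n ℝ) (d : n → ℝ), Uᵀ * U = 1 ∧ U * Uᵀ = 1 ∧ A = U * diagonal d * Uᵀ := by
  have hH : A.IsHermitian := by
    rw [Matrix.IsHermitian, conjTranspose_eq_transpose_of_trivial]; exact hA
  refine ⟨(hH.eigenvectorUnitary : Matrix n n ℝ), hH.eigenvalues, ?_, ?_, ?_⟩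
  · have := Unitary.coe_star_mul_self hH.eigenvectorUnitary
    simpa [star_eq_conjTranspose, conjTranspose_eq_transpose_of_trivial] using this
  · have := Unitary.coe_mul_star_self hH.eigenvectorUnitary
    simpa [star_eq_conjTranspose, conjTranspose_eq_transpose_of_trivial] using this
  · have := hH.spectral_theorem
    rw [Unitary.conjStarAlgAut_apply] at this
    simpa [star_eq_conjTranspose, conjTranspose_eq_transpose_of_trivial] using this

theorem exp_conj_orthogonal {U : Matrix n n ℝ} (h : U * Uᵀ = 1) (d : n → ℝ) :
    NormedSpace.exp (U * diagonal d * Uᵀ) = U * diagonal (fun i => Real.exp (d i)) * Uᵀ := by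
  have hinv : U⁻¹ = Uᵀ := Matrix.inv_eq_right_inv h
  have hu : IsUnit U := by
    rw [Matrix.isUnit_iff_isUnit_det]
    have := congrArg det h
    rw [det_mul, det_one] at this
    exact IsUnit.of_mul_eq_one _ this
  rw [← hinv, Matrix.exp_conj _ _ hu, Matrix.exp_diagonal]
  congr 3
  ext i
  rw [Pi.coe_exp, Real.exp_eq_exp_ℝ]

theorem trace_mul_pow_comm (X Y : Matrix n n ℝ) (k : ℕ) :
    trace ((X * Y) ^ k) = trace ((Y * X) ^ k) := by
  cases k with
  | zero => simp
  | succ k =>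
    have h : ∀ m : ℕ, (X * Y) ^ m * X = X * (Y * X) ^ m := by
      intro m
      induction m with
      | zero => simp
      | succ m ih => rw [pow_succ', mul_assoc, ih, pow_succ']; simp only [mul_assoc]
    rw [pow_succ, ← mul_assoc, h, trace_mul_comm, ← mul_assoc, ← pow_succ']

/-- Weyl's trace inequality for dyadic exponents, together with its consequence for products of
symmetric matrices. -/
theorem trace_pow_two_pow_le (k : ℕ) :
    (∀ X : Matrix n n ℝ, trace (X ^ 2 ^ (k + 1)) ≤ trace ((X * Xᵀ) ^ 2 ^ k)) ∧
    (∀ P Q : Matrix n n ℝ, P.IsSymm → Q.IsSymm →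
      trace ((P * Q) ^ 2 ^ k) ≤
        Real.sqrt (trace (P ^ 2 ^ (k + 1)) * trace (Q ^ 2 ^ (k + 1)))) := by
  induction k with
  | zero =>
    refine ⟨fun X => ?_, fun P Q hP hQ => ?_⟩
    · simpa [sq] using (le_abs_self _).trans (abs_trace_le_of_sq (X := X))
    · have h := trace_mul_sq_le P Q
      rw [hP.eq, hQ.eq] at h
      simpa [sq] using Real.le_sqrt_of_sq_le (by simpa [sq] using h)
  | succ k ih =>
    obtain ⟨ih1, ih2⟩ := ih
    have key : ∀ P Q : Matrix n n ℝ, P.IsSymm → Q.IsSymm →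
      trace ((P * Q) ^ 2 ^ (k + 1)) ≤
        Real.sqrt (trace (P ^ 2 ^ (k + 2)) * trace (Q ^ 2 ^ (k + 2))) := by
      intro P Q hP hQ
      have h1 := ih1 (P * Q)
      have h2 : trace ((P * Q * (P * Q)ᵀ) ^ 2 ^ k) = trace (((P * P) * (Q * Q)) ^ 2 ^ k) := by
        rw [transpose_mul, hP.eq, hQ.eq, mul_assoc, trace_mul_pow_comm, trace_mul_pow_comm (P * P)]
        simp only [mul_assoc]
      have h3 := ih2 (P * P) (Q * Q) (by simp [IsSymm, hP.eq]) (by simp [IsSymm, hQ.eq])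
      rw [← sq, ← sq, ← pow_mul, ← pow_mul, ← pow_succ'] at h3
      rw [h2, ← sq, ← sq] at h1
      exact h1.trans h3
    refine ⟨fun X => ?_, key⟩
    -- Cyclicity turns X X Xᵀ Xᵀ into the product of the symmetric matrices Xᵀ X and X Xᵀ, so the
    -- second half of the induction hypothesis applies. Powers of these two have equal traces, and
    -- the geometric mean collapses to a single trace.
    have h1 := ih1 (X * X)
    have h2 : trace ((X * X * (X * X)ᵀ) ^ 2 ^ k) = trace (((Xᵀ * X) * (X * Xᵀ)) ^ 2 ^ k) := by
      rw [transpose_mul, mul_assoc, trace_mul_pow_comm, trace_mul_pow_comm (Xᵀ * X)]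
      simp only [mul_assoc]
    have h3 := ih2 (Xᵀ * X) (X * Xᵀ) (by simp [IsSymm]) (by simp [IsSymm])
    rw [trace_mul_pow_comm Xᵀ X, Real.sqrt_mul_self] at h3
    · rw [h2] at h1
      rw [← sq, ← pow_mul, ← pow_succ'] at h1
      exact h1.trans h3
    · have : ((X * Xᵀ) ^ 2 ^ (k + 1)) = (X * Xᵀ) ^ 2 ^ k * ((X * Xᵀ) ^ 2 ^ k)ᵀ := by
        rw [transpose_pow]; simp only [transpose_mul, transpose_transpose]
        rw [← pow_add]; congr 1; ring
      rw [this]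
      exact trace_mul_transpose_nonneg _

/-- Weyl's inequality for `P * Q` followed by cyclicity replaces the pair P, Q by P², Q² and halves
the outer exponent; iteration moves the whole exponent inside. -/
theorem trace_mul_pow_two_pow_le {P Q : Matrix n n ℝ} (hP : P.IsSymm) (hQ : Q.IsSymm) (k : ℕ) :
    trace ((P * Q) ^ 2 ^ k) ≤ trace (P ^ 2 ^ k * Q ^ 2 ^ k) := by
  induction k generalizing P Q with
  | zero => simp
  | succ k ih =>
    have h1 := (trace_pow_two_pow_le k).1 (P * Q)
    have h2 : trace ((P * Q * (P * Q)ᵀ) ^ 2 ^ k) = trace (((P * P) * (Q * Q)) ^ 2 ^ k) := by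
      rw [transpose_mul, hP.eq, hQ.eq, mul_assoc, trace_mul_pow_comm, trace_mul_pow_comm (P * P)]
      simp only [mul_assoc]
    have h3 := ih (P := P * P) (Q := Q * Q) (by simp [IsSymm, hP.eq]) (by simp [IsSymm, hQ.eq])
    rw [h2] at h1
    refine h1.trans (h3.trans_eq ?_)
    rw [← sq, ← sq, ← pow_mul, ← pow_mul, ← pow_succ']

end MatrixExp

/-! ### The Lie product formula -/

section LieProduct

variable {𝔸 : Type*} [NormedRing 𝔸] [NormOneClass 𝔸]

/-- Telescoping, one factor at a time. The loss is only linear in the exponent, which an o(1/m)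
difference of the bases absorbs. -/
theorem norm_pow_sub_pow_le {x y : 𝔸} {K : ℝ} (hx : ‖x‖ ≤ K) (hy : ‖y‖ ≤ K) (m : ℕ) :
    ‖x ^ (m + 1) - y ^ (m + 1)‖ ≤ (m + 1) * K ^ m * ‖x - y‖ := by
  have hK : 0 ≤ K := (norm_nonneg x).trans hx
  induction m with
  | zero => simp
  | succ m ih =>
    have e : x ^ (m + 1 + 1) - y ^ (m + 1 + 1)
        = x * (x ^ (m + 1) - y ^ (m + 1)) + (x - y) * y ^ (m + 1) := by
      rw [pow_succ' x (m + 1), pow_succ' y (m + 1)]; noncomm_ring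
    rw [e]
    have h1 : ‖x * (x ^ (m + 1) - y ^ (m + 1))‖ ≤ K * ((m + 1) * K ^ m * ‖x - y‖) :=
      (norm_mul_le _ _).trans (mul_le_mul hx ih (norm_nonneg _) hK)
    have h2 : ‖(x - y) * y ^ (m + 1)‖ ≤ ‖x - y‖ * K ^ (m + 1) :=
      (norm_mul_le _ _).trans (mul_le_mul_of_nonneg_left
        ((norm_pow_le _ _).trans (pow_le_pow_left₀ (norm_nonneg _) hy _)) (norm_nonneg _))
    refine (norm_add_le _ _).trans ((add_le_add h1 h2).trans_eq ?_)
    push_cast; ring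

variable [NormedAlgebra ℝ 𝔸]

theorem norm_exp_le_exp_norm (x : 𝔸) : ‖NormedSpace.exp x‖ ≤ Real.exp ‖x‖ := by
  rw [NormedSpace.exp_eq_tsum ℝ]
  have h := NormedSpace.exp_series_hasSum_exp' (𝕂 := ℝ) ‖x‖
  rw [← Real.exp_eq_exp_ℝ] at h
  refine tsum_of_norm_bounded h fun i => ?_
  rw [norm_smul, Real.norm_of_nonneg (by positivity), smul_eq_mul]
  exact mul_le_mul_of_nonneg_left (norm_pow_le x i) (by positivity)

variable [CompleteSpace 𝔸]

/-- The Lie product formula. -/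
theorem tendsto_exp_mul_exp_pow (a b : 𝔸) :
    Tendsto (fun m : ℕ => (NormedSpace.exp (((m : ℝ) + 1)⁻¹ • a)
      * NormedSpace.exp (((m : ℝ) + 1)⁻¹ • b)) ^ (m + 1)) atTop (𝓝 (NormedSpace.exp (a + b))) := by
  set f : ℝ → 𝔸 := fun t => NormedSpace.exp (t • a) * NormedSpace.exp (t • b) with hf
  set g : ℝ → 𝔸 := fun t => NormedSpace.exp (t • (a + b)) with hg
  have hd : ∀ c : 𝔸, HasDerivAt (fun t : ℝ => NormedSpace.exp (t • c)) c 0 := by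
    intro c
    have := hasDerivAt_exp_smul_const (𝕂 := ℝ) c (0 : ℝ)
    simpa using this
  -- Both curves start at 1 with derivative a + b, so at time 1/(m+1) they differ by o(1/m).
  have hfg : HasDerivAt (fun t => f t - g t) 0 0 := by
    have := ((hd a).mul (hd b)).sub (hd (a + b))
    simp only [zero_smul, NormedSpace.exp_zero, mul_one, one_mul, sub_self] at this
    exact this
  have hlim : Tendsto (fun m : ℕ => ((m : ℝ) + 1) * ‖f ((m : ℝ) + 1)⁻¹ - g ((m : ℝ) + 1)⁻¹‖)
      atTop (𝓝 0) := by
    have h0 := hfg.tendsto_slope_zero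
    have hseq : Tendsto (fun m : ℕ => ((m : ℝ) + 1)⁻¹) atTop (𝓝[≠] 0) := by
      refine tendsto_nhdsWithin_iff.2 ⟨?_, Eventually.of_forall fun m => ?_⟩
      · simpa using tendsto_one_div_add_atTop_nhds_zero_nat (𝕜 := ℝ)
      · simp only [Set.mem_compl_iff, Set.mem_singleton_iff]; positivity
    have h1 := (h0.comp hseq).norm
    simp only [norm_zero] at h1
    refine h1.congr fun m => ?_
    have hm : (0 : ℝ) ≤ (m : ℝ) + 1 := by positivity
    simp [norm_smul, hf, hg, abs_of_nonneg hm]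
  have hexp : ∀ c : 𝔸, ‖NormedSpace.exp c‖ ≤ Real.exp ‖c‖ := norm_exp_le_exp_norm
  rw [tendsto_iff_norm_sub_tendsto_zero]
  have hlim' := hlim.const_mul (Real.exp (‖a‖ + ‖b‖))
  rw [mul_zero] at hlim'
  refine squeeze_zero (fun _ => norm_nonneg _) (fun m => ?_) hlim'
  have hm : (0 : ℝ) < (m : ℝ) + 1 := by positivity
  set t : ℝ := ((m : ℝ) + 1)⁻¹ with ht
  have ht0 : 0 < t := by positivity
  set K : ℝ := Real.exp (t * (‖a‖ + ‖b‖)) with hK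
  have hKf : ‖f t‖ ≤ K := by
    refine (norm_mul_le _ _).trans ?_
    rw [hK, mul_add, Real.exp_add]
    have h1 := hexp (t • a)
    have h2 := hexp (t • b)
    rw [norm_smul, Real.norm_of_nonneg ht0.le] at h1 h2
    exact mul_le_mul h1 h2 (norm_nonneg _) (Real.exp_nonneg _)
  have hKg : ‖g t‖ ≤ K := by
    refine (hexp _).trans (Real.exp_le_exp.2 ?_)
    rw [norm_smul, Real.norm_of_nonneg ht0.le]
    exact mul_le_mul_of_nonneg_left (norm_add_le _ _) ht0.le
  have hgpow : g t ^ (m + 1) = NormedSpace.exp (a + b) := by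
    rw [hg]
    simp only
    let _ : NormedAlgebra ℚ 𝔸 := NormedAlgebra.restrictScalars ℚ ℝ 𝔸
    rw [← NormedSpace.exp_nsmul]
    congr 1
    rw [← Nat.cast_smul_eq_nsmul ℝ, smul_smul, ht]
    push_cast
    rw [mul_inv_cancel₀ hm.ne', one_smul]
  rw [← hgpow]
  refine (norm_pow_sub_pow_le hKf hKg m).trans ?_
  have hKm : K ^ m ≤ Real.exp (‖a‖ + ‖b‖) := by
    rw [hK, ← Real.exp_nat_mul]
    refine Real.exp_le_exp.2 ?_
    rw [← mul_assoc]
    refine mul_le_of_le_one_left (by positivity) ?_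
    rw [ht, ← div_eq_mul_inv, div_le_one hm]
    linarith
  calc ((m : ℝ) + 1) * K ^ m * ‖f t - g t‖
      = K ^ m * (((m : ℝ) + 1) * ‖f t - g t‖) := by ring
    _ ≤ _ := mul_le_mul_of_nonneg_right hKm (by positivity)

end LieProduct

/-! ### The Golden–Thompson inequality -/

section GoldenThompson

variable {n : Type*} [Fintype n] [DecidableEq n]

open scoped Matrix.Norms.Operator in
/-- The Golden–Thompson inequality for real symmetric matrices. -/
theorem trace_exp_add_le {A B : Matrix n n ℝ} (hA : A.IsSymm) (hB : B.IsSymm) :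
    trace (NormedSpace.exp (A + B)) ≤ trace (NormedSpace.exp A * NormedSpace.exp B) := by
  cases isEmpty_or_nonempty n with
  | inl h => simp [trace]
  | inr h =>
  have hlim := tendsto_exp_mul_exp_pow A B
  -- The trace inequality covers only dyadic exponents, so the limit is taken along m + 1 = 2 ^ k.
  have hsub : Tendsto (fun k : ℕ => 2 ^ k - 1) atTop atTop :=
    tendsto_atTop_mono (fun k => Nat.le_sub_one_of_lt Nat.lt_two_pow_self) tendsto_id
  have htr : Continuous (fun M : Matrix n n ℝ => trace M) := continuous_id.matrix_trace
  have h1 := (htr.tendsto _).comp (hlim.comp hsub)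
  refine le_of_tendsto h1 (Eventually.of_forall fun k => ?_)
  have hk : 2 ^ k - 1 + 1 = 2 ^ k := Nat.sub_add_cancel Nat.one_le_two_pow
  simp only [Function.comp_apply]
  rw [hk]
  set t : ℝ := (((2 ^ k - 1 : ℕ) : ℝ) + 1)⁻¹ with ht
  have htk : ((2 ^ k : ℕ) : ℝ) * t = 1 := by
    have : (((2 ^ k - 1 : ℕ) : ℝ) + 1) = ((2 ^ k : ℕ) : ℝ) := by exact_mod_cast hk
    rw [ht, this, mul_inv_cancel₀ (by positivity)]
  have hpow : ∀ M : Matrix n n ℝ, NormedSpace.exp (t • M) ^ 2 ^ k = NormedSpace.exp M := by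
    intro M
    rw [← Matrix.exp_nsmul, ← Nat.cast_smul_eq_nsmul ℝ, smul_smul, htk, one_smul]
  have h2 := trace_mul_pow_two_pow_le (P := NormedSpace.exp (t • A)) (Q := NormedSpace.exp (t • B))
    (IsSymm.exp (hA.smul t)) (IsSymm.exp (hB.smul t)) k
  rwa [hpow, hpow] at h2

end GoldenThompson

/-! ### Quadratic forms and the matrix exponential -/

section QuadraticForm

variable {n : Type*} [Fintype n]

/-- `|xᵀ M x| ≤ ε |x|²` for all `x`. -/
def FormBound (M : Matrix n n ℝ) (ε : ℝ) : Prop := ∀ x : n → ℝ, |x ⬝ᵥ (M *ᵥ x)| ≤ ε * (x ⬝ᵥ x)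

theorem dotProduct_self_eq (x : n → ℝ) : x ⬝ᵥ x = ∑ i, x i ^ 2 := by
  simp [dotProduct, sq]

variable [DecidableEq n]

theorem dotProduct_orthogonal_mulVec {U : Matrix n n ℝ} (h : U * Uᵀ = 1) (x : n → ℝ) :
    (Uᵀ *ᵥ x) ⬝ᵥ (Uᵀ *ᵥ x) = x ⬝ᵥ x := by
  rw [dotProduct_mulVec, vecMul_transpose, mulVec_mulVec, h, one_mulVec]

theorem dotProduct_conj_diagonal_mulVec (U : Matrix n n ℝ) (d : n → ℝ) (x : n → ℝ) :
    x ⬝ᵥ ((U * diagonal d * Uᵀ) *ᵥ x) = ∑ i, d i * (Uᵀ *ᵥ x) i ^ 2 := by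
  rw [← mulVec_mulVec, ← mulVec_mulVec, dotProduct_mulVec, ← mulVec_transpose]
  simp only [dotProduct, mulVec_diagonal]
  exact Finset.sum_congr rfl fun i _ => by ring

/-- Each diagonal entry of an orthogonal diagonalization is an eigenvalue with a unit eigenvector. -/
theorem diagonalization_eigenvalue {U : Matrix n n ℝ} (h : Uᵀ * U = 1) (d : n → ℝ) (i : n) :
    ∃ x : n → ℝ, x ⬝ᵥ x = 1 ∧ (U * diagonal d * Uᵀ) *ᵥ x = d i • x ∧ x ≠ 0 := by
  refine ⟨U *ᵥ Pi.single i 1, ?_, ?_, ?_⟩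
  · rw [dotProduct_mulVec, ← mulVec_transpose, mulVec_mulVec, h, one_mulVec]
    simp
  · rw [mulVec_mulVec, mul_assoc, h, mul_one, ← mulVec_mulVec, diagonal_mulVec_single,
      ← mulVec_smul]
    congr 1
    ext j
    by_cases hj : j = i <;> simp [hj]
  · intro h0
    have := congrArg (fun v => Uᵀ *ᵥ v) h0
    simp only [mulVec_mulVec, h, one_mulVec, mulVec_zero] at this
    have := congrFun this i
    simp at this

/-- The factor exp |t| is kept rather than bounded by a constant: it later becomes the tilt of the
product measure. -/
theorem exp_le_one_add_add_sq (t : ℝ) : Real.exp t ≤ 1 + t + t ^ 2 * Real.exp |t| := by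
  have h := Complex.norm_exp_sub_sum_le_norm_mul_exp (t : ℂ) 2
  have e : Complex.exp (t : ℂ) - ∑ m ∈ Finset.range 2, (t : ℂ) ^ m / (m.factorial : ℂ)
      = ((Real.exp t - (1 + t) : ℝ) : ℂ) := by
    simp [Finset.sum_range_succ]
  rw [e, Complex.norm_real, Complex.norm_real, Real.norm_eq_abs, Real.norm_eq_abs, sq_abs] at h
  have := (abs_le.1 h).2
  linarith

/-- The scalar inequality is applied to each eigenvalue in an eigenbasis; the form bound, tested on
unit eigenvectors, confines the eigenvalues to [-ρ, ρ]. -/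
theorem dotProduct_exp_mulVec_le {M : Matrix n n ℝ} (hM : M.IsSymm) {ρ : ℝ} (h : FormBound M ρ)
    (x : n → ℝ) :
    x ⬝ᵥ (NormedSpace.exp M *ᵥ x) ≤
      x ⬝ᵥ x + x ⬝ᵥ (M *ᵥ x) + Real.exp ρ * ((M *ᵥ x) ⬝ᵥ (M *ᵥ x)) := by
  obtain ⟨U, d, h1, h2, rfl⟩ := exists_orthogonal_diagonalization hM
  have hd : ∀ i, |d i| ≤ ρ := by
    intro i
    obtain ⟨v, hv1, hv2, -⟩ := diagonalization_eigenvalue h1 d i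
    have := h v
    rw [hv2, dotProduct_smul, hv1] at this
    simpa using this
  have hsq : ((U * diagonal d * Uᵀ) *ᵥ x) ⬝ᵥ ((U * diagonal d * Uᵀ) *ᵥ x)
      = ∑ i, (d i) ^ 2 * (Uᵀ *ᵥ x) i ^ 2 := by
    rw [← mulVec_mulVec, ← mulVec_mulVec, dotProduct_mulVec, ← mulVec_transpose, mulVec_mulVec, h1,
      one_mulVec]
    simp only [dotProduct, mulVec_diagonal]
    exact Finset.sum_congr rfl fun i _ => by ring
  rw [exp_conj_orthogonal h2, hsq, dotProduct_conj_diagonal_mulVec, dotProduct_conj_diagonal_mulVec,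
    ← dotProduct_orthogonal_mulVec h2 x, dotProduct, Finset.mul_sum, ← Finset.sum_add_distrib,
    ← Finset.sum_add_distrib]
  refine Finset.sum_le_sum fun i _ => ?_
  have e := exp_le_one_add_add_sq (d i)
  have e2 : d i ^ 2 * Real.exp |d i| ≤ d i ^ 2 * Real.exp ρ :=
    mul_le_mul_of_nonneg_left (Real.exp_le_exp.2 (hd i)) (sq_nonneg _)
  have e3 : Real.exp (d i) ≤ 1 + d i + d i ^ 2 * Real.exp ρ := by linarith
  have := mul_le_mul_of_nonneg_right e3 (sq_nonneg ((Uᵀ *ᵥ x) i))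
  nlinarith [this]

/-- The trace is the sum of the exponentials of the eigenvalues, so it dominates each of them. -/
theorem dotProduct_mulVec_le_of_trace_exp_lt {M : Matrix n n ℝ} (hM : M.IsSymm) {t : ℝ}
    (h : trace (NormedSpace.exp M) < Real.exp t) (x : n → ℝ) : x ⬝ᵥ (M *ᵥ x) ≤ t * (x ⬝ᵥ x) := by
  obtain ⟨U, d, h1, h2, rfl⟩ := exists_orthogonal_diagonalization hM
  rw [exp_conj_orthogonal h2, trace_mul_comm, ← mul_assoc, h1, one_mul, trace_diagonal] at h
  have hd : ∀ i, d i ≤ t := by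
    intro i
    by_contra hc
    have h3 : Real.exp (d i) ≤ ∑ j, Real.exp (d j) :=
      Finset.single_le_sum (f := fun j => Real.exp (d j)) (fun j _ => (Real.exp_pos _).le)
        (Finset.mem_univ i)
    have := Real.exp_lt_exp.2 (not_le.1 hc)
    linarith
  rw [dotProduct_conj_diagonal_mulVec, ← dotProduct_orthogonal_mulVec h2 x, dotProduct,
    Finset.mul_sum]
  refine Finset.sum_le_sum fun i _ => ?_
  have := mul_le_mul_of_nonneg_right (hd i) (sq_nonneg ((Uᵀ *ᵥ x) i))
  linarith

/-- With the symmetric square root R of exp M, the trace of R R Q is the sum of the quadratic form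
of Q over the rows of R, and the bound on Q applies row by row. -/
theorem trace_exp_mul_le {M Q : Matrix n n ℝ} (hM : M.IsSymm) {κ : ℝ}
    (hQ : ∀ x : n → ℝ, x ⬝ᵥ (Q *ᵥ x) ≤ κ * (x ⬝ᵥ x)) :
    trace (NormedSpace.exp M * Q) ≤ κ * trace (NormedSpace.exp M) := by
  set R : Matrix n n ℝ := NormedSpace.exp ((2 : ℝ)⁻¹ • M) with hR
  have hRs : R.IsSymm := IsSymm.exp (hM.smul _)
  have hRR : NormedSpace.exp M = R * R := by
    rw [← sq, hR, ← Matrix.exp_nsmul, ← Nat.cast_smul_eq_nsmul ℝ, smul_smul]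
    norm_num
  have key : ∀ Q : Matrix n n ℝ, trace (R * R * Q) = ∑ i, R i ⬝ᵥ (Q *ᵥ R i) := by
    intro Q
    rw [mul_assoc, trace_mul_comm, mul_assoc]
    simp only [trace, diag]
    refine Finset.sum_congr rfl fun i _ => ?_
    rw [mul_apply]
    refine Finset.sum_congr rfl fun j _ => ?_
    rw [mul_apply]
    simp only [mulVec, dotProduct]
    congr 1
    exact Finset.sum_congr rfl fun l _ => by rw [hRs.apply]
  have h1 := key Q
  have h2 := key 1
  rw [mul_one] at h2
  rw [hRR, h1, h2, Finset.mul_sum]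
  refine Finset.sum_le_sum fun i _ => ?_
  simpa using hQ (R i)

end QuadraticForm

/-! ### Expectations under finite product weights -/

section ProductExpectation

variable {ι Ω : Type*} [Fintype ι] [DecidableEq ι] [Fintype Ω]

/-- The expectation of `F` when the coordinates are independent, coordinate `i` having the
weights `w i`. -/
noncomputable def prodExp (w : ι → Ω → ℝ) (F : (ι → Ω) → ℝ) : ℝ :=
  ∑ f : ι → Ω, (∏ i, w i (f i)) * F f

theorem prodExp_prod (w g : ι → Ω → ℝ) :
    prodExp w (fun f => ∏ i, g i (f i)) = ∏ i, ∑ a, w i a * g i a := by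
  rw [prodExp, Finset.prod_univ_sum, Fintype.piFinset_univ]
  simp only [Finset.prod_mul_distrib]

theorem prodExp_mono {w : ι → Ω → ℝ} (hw : ∀ i a, 0 ≤ w i a) {F G : (ι → Ω) → ℝ}
    (h : ∀ f, F f ≤ G f) : prodExp w F ≤ prodExp w G :=
  Finset.sum_le_sum fun f _ => mul_le_mul_of_nonneg_left (h f) (Finset.prod_nonneg fun i _ => hw i _)

theorem prodExp_add (w : ι → Ω → ℝ) (F G : (ι → Ω) → ℝ) :
    prodExp w (fun f => F f + G f) = prodExp w F + prodExp w G := by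
  simp only [prodExp, mul_add, Finset.sum_add_distrib]

theorem prodExp_sum {κ : Type*} (w : ι → Ω → ℝ) (s : Finset κ) (F : κ → (ι → Ω) → ℝ) :
    prodExp w (fun f => ∑ k ∈ s, F k f) = ∑ k ∈ s, prodExp w (F k) := by
  simp only [prodExp, Finset.mul_sum]
  exact Finset.sum_comm

theorem prodExp_const_mul (w : ι → Ω → ℝ) (c : ℝ) (F : (ι → Ω) → ℝ) :
    prodExp w (fun f => c * F f) = c * prodExp w F := by
  simp only [prodExp, Finset.mul_sum]
  exact Finset.sum_congr rfl fun f _ => by ring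

theorem prodExp_const {w : ι → Ω → ℝ} (h1 : ∀ i, ∑ a, w i a = 1) (c : ℝ) :
    prodExp w (fun _ => c) = c := by
  have h := prodExp_prod w (fun _ _ => 1)
  simp only [Finset.prod_const_one, mul_one, h1] at h
  have := prodExp_const_mul w c (fun _ => 1)
  simp only [mul_one, h] at this
  exact this

open Classical in
/-- Markov's inequality. -/
theorem prodExp_indicator_le {w : ι → Ω → ℝ} (hw : ∀ i a, 0 ≤ w i a) {F : (ι → Ω) → ℝ}
    (hF : ∀ f, 0 ≤ F f) {t : ℝ} (ht : 0 < t) :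
    prodExp w (fun f => if t ≤ F f then 1 else 0) ≤ prodExp w F / t := by
  rw [div_eq_inv_mul, ← prodExp_const_mul]
  refine prodExp_mono hw fun f => ?_
  split_ifs with h
  · rw [← div_eq_inv_mul, le_div_iff₀ ht]; linarith
  · exact mul_nonneg (inv_nonneg.2 ht.le) (hF f)

/-- Regroups independent matrix entries into independent columns, the units to which matrix
concentration is applied. -/
theorem prodExp_curry {κ : Type*} [Fintype κ] [DecidableEq κ] (w : ι × κ → Ω → ℝ)
    (F : (ι × κ → Ω) → ℝ) :
    prodExp w F = prodExp (fun j (c : ι → Ω) => ∏ i, w (i, j) (c i))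
      (fun f : κ → ι → Ω => F (fun ij => f ij.2 ij.1)) := by
  unfold prodExp
  refine (Fintype.sum_equiv
    ((Equiv.arrowCongr (Equiv.prodComm ι κ) (Equiv.refl Ω)).trans (Equiv.curry κ ι Ω)) _ _
    fun f => ?_)
  congr 1
  rw [Fintype.prod_prod_type_right]
  rfl

end ProductExpectation

/-! ### The Ahlswede–Winter method -/

section AhlswedeWinter

variable {n : Type*} [Fintype n] {Ω : Type*} [Fintype Ω]

theorem sum_smul_dotProduct_mulVec (w : Ω → ℝ) (X : Ω → Matrix n n ℝ) (x : n → ℝ) :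
    x ⬝ᵥ ((∑ a, w a • X a) *ᵥ x) = ∑ a, w a * (x ⬝ᵥ (X a *ᵥ x)) := by
  rw [sum_mulVec, dotProduct_sum]
  exact Finset.sum_congr rfl fun a _ => by rw [smul_mulVec, dotProduct_smul, smul_eq_mul]

variable [DecidableEq n]

/-- The Ahlswede–Winter bound on the trace exponential of a sum of independent symmetric
matrices. -/
theorem prodExp_trace_exp_add_sum_le {m : ℕ} (w : Fin m → Ω → ℝ) (hw : ∀ j a, 0 ≤ w j a)
    (X : Fin m → Ω → Matrix n n ℝ) (hX : ∀ j a, (X j a).IsSymm) {κ : ℝ} (hκ : 0 ≤ κ)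
    (h : ∀ j x, ∑ a, w j a * (x ⬝ᵥ (NormedSpace.exp (X j a) *ᵥ x)) ≤ κ * (x ⬝ᵥ x))
    {S : Matrix n n ℝ} (hS : S.IsSymm) :
    prodExp w (fun f => trace (NormedSpace.exp (S + ∑ j, X j (f j)))) ≤
      κ ^ m * trace (NormedSpace.exp S) := by
  induction m generalizing S with
  | zero => simp [prodExp]
  | succ m ih =>
    -- The first random summand is absorbed into S, which is why S is carried through the induction.
    -- Golden–Thompson then splits it off again so that it can be averaged alone.
    have e : prodExp w (fun f => trace (NormedSpace.exp (S + ∑ j, X j (f j)))) =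
        ∑ a, w 0 a * prodExp (fun j => w j.succ) (fun f =>
          trace (NormedSpace.exp ((S + X 0 a) + ∑ j, X (Fin.succ j) (f j)))) := by
      unfold prodExp
      rw [← (Fin.consEquiv (fun _ => Ω)).sum_comp, Fintype.sum_prod_type]
      refine Finset.sum_congr rfl fun a _ => ?_
      rw [Finset.mul_sum]
      refine Finset.sum_congr rfl fun f _ => ?_
      simp [Fin.consEquiv, Fin.prod_univ_succ, Fin.sum_univ_succ, mul_assoc, add_assoc]
    rw [e]
    have h1 : ∀ a, prodExp (fun j => w j.succ) (fun f =>
          trace (NormedSpace.exp ((S + X 0 a) + ∑ j, X (Fin.succ j) (f j)))) ≤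
        κ ^ m * trace (NormedSpace.exp S * NormedSpace.exp (X 0 a)) := fun a =>
      (ih (fun j => w j.succ) (fun j a => hw _ a) (fun j => X j.succ) (fun j a => hX _ a)
        (fun j x => h _ x) (hS.add (hX 0 a))).trans
        (mul_le_mul_of_nonneg_left (trace_exp_add_le hS (hX 0 a)) (pow_nonneg hκ m))
    calc _ ≤ ∑ a, w 0 a * (κ ^ m * trace (NormedSpace.exp S * NormedSpace.exp (X 0 a))) :=
          Finset.sum_le_sum fun a _ => mul_le_mul_of_nonneg_left (h1 a) (hw 0 a)
      _ = κ ^ m * trace (NormedSpace.exp S * ∑ a, w 0 a • NormedSpace.exp (X 0 a)) := by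
          rw [Finset.mul_sum, trace_sum, Finset.mul_sum]
          refine Finset.sum_congr rfl fun a _ => ?_
          rw [mul_smul_comm, trace_smul, smul_eq_mul]; ring
      _ ≤ κ ^ m * (κ * trace (NormedSpace.exp S)) := by
          refine mul_le_mul_of_nonneg_left (trace_exp_mul_le hS fun x => ?_) (pow_nonneg hκ m)
          rw [sum_smul_dotProduct_mulVec]
          exact h 0 x
      _ = _ := by ring

end AhlswedeWinter

/-! ### Bernoulli variables and their exponentially tilted moments -/

/-- The weights of the Bernoulli law with parameter `q`. -/
noncomputable def berWeight (q : ℝ) (b : Bool) : ℝ := if b then q else 1 - q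

/-- A Bernoulli variable with parameter `q`, centered. -/
noncomputable def berCentered (q : ℝ) (b : Bool) : ℝ := (if b then 1 else 0) - q

theorem berWeight_nonneg {q : ℝ} (h0 : 0 ≤ q) (h1 : q ≤ 1) (b : Bool) : 0 ≤ berWeight q b := by
  cases b <;> simp [berWeight] <;> linarith

theorem sum_berWeight (q : ℝ) : ∑ b, berWeight q b = 1 := by
  simp [berWeight]

theorem sum_berWeight_mul_berCentered (q : ℝ) : ∑ b, berWeight q b * berCentered q b = 0 := by
  simp [berWeight, berCentered]; ring

theorem abs_berCentered_le {q : ℝ} (h0 : 0 ≤ q) (h1 : q ≤ 1) (b : Bool) :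
    |berCentered q b| ≤ 1 := by
  cases b <;> simp [berCentered, abs_le] <;> constructor <;> linarith

theorem sum_berWeight_mul_sq {q : ℝ} : ∑ b, berWeight q b * berCentered q b ^ 2 = q * (1 - q) := by
  simp [berWeight, berCentered]; ring

theorem sum_berWeight_mul_sq_le {q p : ℝ} (h0 : 0 ≤ q) (hp : q ≤ 2 * p) :
    ∑ b, berWeight q b * berCentered q b ^ 2 ≤ 2 * p := by
  rw [sum_berWeight_mul_sq]; nlinarith

section Tilted

variable {q p u : ℝ} (h0 : 0 ≤ q) (h1 : q ≤ 1) (hp : q ≤ 2 * p) (hu0 : 0 ≤ u) (hu1 : u ≤ 1)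

include h0 h1 hu0 hu1 in
theorem exp_mul_sq_berCentered_le (b : Bool) :
    Real.exp (u * berCentered q b ^ 2) ≤ 1 + 3 * (u * berCentered q b ^ 2) ∧
      Real.exp (u * berCentered q b ^ 2) ≤ 3 := by
  have hw := abs_berCentered_le h0 h1 b
  have hw2 : berCentered q b ^ 2 ≤ 1 := by
    rw [← sq_abs]; exact pow_le_one₀ (abs_nonneg _) hw
  set t := u * berCentered q b ^ 2 with ht
  have ht0 : 0 ≤ t := by positivity
  have ht1 : t ≤ 1 := mul_le_one₀ hu1 (sq_nonneg _) hw2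
  have h3 : Real.exp t ≤ 3 := by
    have := Real.exp_le_exp.2 ht1
    have := Real.exp_one_lt_d9
    linarith
  refine ⟨?_, h3⟩
  -- Multiplying by exp t gives exp t - 1 ≤ t exp t ≤ 3 t.
  have h4 : 1 - t ≤ Real.exp (-t) := by have := Real.add_one_le_exp (-t); linarith
  have h5 : Real.exp t * Real.exp (-t) = 1 := by rw [← Real.exp_add]; simp
  nlinarith [Real.exp_pos t]

include h0 h1 hu0 hu1 hp in
theorem tilted_mass_le :
    ∑ b, berWeight q b * Real.exp (u * berCentered q b ^ 2) ≤ Real.exp (6 * u * p) := by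
  have h2 := sum_berWeight_mul_sq_le h0 hp
  calc ∑ b, berWeight q b * Real.exp (u * berCentered q b ^ 2)
      ≤ ∑ b, (berWeight q b + 3 * u * (berWeight q b * berCentered q b ^ 2)) := by
        refine Finset.sum_le_sum fun b _ => ?_
        have := mul_le_mul_of_nonneg_left (exp_mul_sq_berCentered_le h0 h1 hu0 hu1 b).1
          (berWeight_nonneg h0 h1 b)
        linarith
    _ = 1 + 3 * u * ∑ b, berWeight q b * berCentered q b ^ 2 := by
        rw [Finset.sum_add_distrib, sum_berWeight, ← Finset.mul_sum]
    _ ≤ 1 + 6 * u * p := by nlinarith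
    _ ≤ _ := by have := Real.add_one_le_exp (6 * u * p); linarith

include h0 h1 hu0 in
theorem one_le_tilted_mass : 1 ≤ ∑ b, berWeight q b * Real.exp (u * berCentered q b ^ 2) := by
  rw [← sum_berWeight q]
  refine Finset.sum_le_sum fun b _ => le_mul_of_one_le_right (berWeight_nonneg h0 h1 b) ?_
  exact Real.one_le_exp (by positivity)

include h0 h1 hu0 hu1 hp in
theorem tilted_second_moment_le :
    ∑ b, berWeight q b * (Real.exp (u * berCentered q b ^ 2) * berCentered q b ^ 2) ≤ 6 * p := by
  have h2 := sum_berWeight_mul_sq_le h0 hp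
  calc _ ≤ ∑ b, 3 * (berWeight q b * berCentered q b ^ 2) := by
        refine Finset.sum_le_sum fun b _ => ?_
        have := mul_le_mul_of_nonneg_left (exp_mul_sq_berCentered_le h0 h1 hu0 hu1 b).2
          (mul_nonneg (berWeight_nonneg h0 h1 b) (sq_nonneg (berCentered q b)))
        linarith
    _ ≤ _ := by rw [← Finset.mul_sum]; linarith

include h0 h1 hu0 hu1 hp in
-- The untilted mean vanishes, so only exp(u w²) - 1 ≤ 3 u w² contributes. The gained factor u makes
-- the sum over unequal indices affordable later.
theorem abs_tilted_first_moment_le :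
    |∑ b, berWeight q b * (Real.exp (u * berCentered q b ^ 2) * berCentered q b)| ≤
      6 * u * p := by
  have h2 := sum_berWeight_mul_sq_le h0 hp
  have e : ∑ b, berWeight q b * (Real.exp (u * berCentered q b ^ 2) * berCentered q b)
      = ∑ b, berWeight q b * ((Real.exp (u * berCentered q b ^ 2) - 1) * berCentered q b) := by
    have := sum_berWeight_mul_berCentered q
    rw [← sub_zero (∑ b, berWeight q b * (Real.exp (u * berCentered q b ^ 2) * berCentered q b)),
      ← this, ← Finset.sum_sub_distrib]
    exact Finset.sum_congr rfl fun b _ => by ring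
  rw [e]
  calc _ ≤ ∑ b, 3 * u * (berWeight q b * berCentered q b ^ 2) := by
        refine (Finset.abs_sum_le_sum_abs _ _).trans (Finset.sum_le_sum fun b _ => ?_)
        have hw := berWeight_nonneg h0 h1 b
        have h3 := (exp_mul_sq_berCentered_le h0 h1 hu0 hu1 b).1
        have h4 : 0 ≤ Real.exp (u * berCentered q b ^ 2) - 1 :=
          sub_nonneg.2 (Real.one_le_exp (by positivity))
        rw [abs_mul, abs_mul, abs_of_nonneg hw, abs_of_nonneg h4]
        have h5 : (Real.exp (u * berCentered q b ^ 2) - 1) * |berCentered q b|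
            ≤ 3 * (u * berCentered q b ^ 2) * 1 :=
          mul_le_mul (by linarith) (abs_berCentered_le h0 h1 b) (abs_nonneg _) (by positivity)
        have := mul_le_mul_of_nonneg_left h5 hw
        linarith
    _ ≤ _ := by rw [← Finset.mul_sum]; nlinarith

end Tilted

/-! ### The hollowed Gram matrix of one column -/

section Column

variable {I : Type*} [DecidableEq I]

/-- The Gram matrix of a vector, with its diagonal removed. -/
def offDiagGram (w : I → ℝ) : Matrix I I ℝ := Matrix.of fun i k => if i = k then 0 else w i * w k

theorem offDiagGram_isSymm (w : I → ℝ) : (offDiagGram w).IsSymm := by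
  ext i k
  by_cases h : i = k
  · simp [offDiagGram, h]
  · simp [offDiagGram, h, Ne.symm h, mul_comm]

variable [Fintype I]

theorem offDiagGram_mulVec (w x : I → ℝ) (i : I) :
    (offDiagGram w *ᵥ x) i = w i * ∑ k, if i = k then 0 else w k * x k := by
  rw [mulVec, dotProduct, Finset.mul_sum]
  refine Finset.sum_congr rfl fun k _ => ?_
  by_cases h : i = k <;> simp [offDiagGram, h, mul_assoc]

theorem dotProduct_offDiagGram_mulVec (w x : I → ℝ) :
    x ⬝ᵥ (offDiagGram w *ᵥ x) = (w ⬝ᵥ x) ^ 2 - ∑ i, w i ^ 2 * x i ^ 2 := by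
  have h : ∀ i, (∑ k, if i = k then 0 else w k * x k) = w ⬝ᵥ x - w i * x i := by
    intro i
    have : ∀ k, (if i = k then 0 else w k * x k) = w k * x k - if i = k then w k * x k else 0 := by
      intro k; split_ifs <;> ring
    simp only [this, Finset.sum_sub_distrib, Finset.sum_ite_eq, Finset.mem_univ, if_true]
    rfl
  rw [dotProduct]
  simp only [offDiagGram_mulVec, h]
  calc _ = ∑ i, ((w ⬝ᵥ x) * (w i * x i) - w i ^ 2 * x i ^ 2) :=
        Finset.sum_congr rfl fun i _ => by ring
    _ = _ := by
        rw [Finset.sum_sub_distrib, ← Finset.mul_sum, sq (w ⬝ᵥ x)]; rfl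

theorem formBound_offDiagGram (w : I → ℝ) : FormBound (offDiagGram w) (∑ i, w i ^ 2) := by
  intro x
  rw [dotProduct_offDiagGram_mulVec, dotProduct_self_eq]
  have h1 : (w ⬝ᵥ x) ^ 2 ≤ (∑ i, w i ^ 2) * ∑ i, x i ^ 2 := Finset.sum_mul_sq_le_sq_mul_sq _ _ _
  have h2 : ∑ i, w i ^ 2 * x i ^ 2 ≤ (∑ i, w i ^ 2) * ∑ i, x i ^ 2 := by
    rw [Finset.sum_mul]
    refine Finset.sum_le_sum fun i _ => mul_le_mul_of_nonneg_left ?_ (sq_nonneg _)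
    exact Finset.single_le_sum (f := fun i => x i ^ 2) (fun i _ => sq_nonneg _) (Finset.mem_univ i)
  have h3 : 0 ≤ ∑ i, w i ^ 2 * x i ^ 2 := Finset.sum_nonneg fun i _ => by positivity
  rw [abs_le]
  constructor <;> nlinarith [sq_nonneg (w ⬝ᵥ x)]

theorem offDiagGram_mulVec_sq (w x : I → ℝ) :
    (offDiagGram w *ᵥ x) ⬝ᵥ (offDiagGram w *ᵥ x) =
      ∑ i, ∑ l, ∑ k, (if i = l ∨ i = k then 0 else w i ^ 2 * w l * w k * (x l * x k)) := by
  rw [dotProduct]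
  refine Finset.sum_congr rfl fun i _ => ?_
  rw [offDiagGram_mulVec]
  calc _ = w i ^ 2 * ((∑ k, if i = k then 0 else w k * x k) * ∑ k, if i = k then 0 else w k * x k)
        := by ring
    _ = _ := by
        rw [Finset.sum_mul_sum, Finset.mul_sum]
        refine Finset.sum_congr rfl fun l _ => ?_
        rw [Finset.mul_sum]
        refine Finset.sum_congr rfl fun k _ => ?_
        by_cases h1 : i = l <;> by_cases h2 : i = k <;> simp [h1, h2]
        ring

variable {q : I → ℝ} {p u : ℝ} (h0 : ∀ i, 0 ≤ q i) (h1 : ∀ i, q i ≤ 1) (hp : ∀ i, q i ≤ 2 * p)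
  (hu0 : 0 ≤ u) (hu1 : u ≤ 1)

theorem prodExp_berCentered_mul {i k : I} (hik : i ≠ k) :
    prodExp (fun i => berWeight (q i))
      (fun c => berCentered (q i) (c i) * berCentered (q k) (c k)) = 0 := by
  have h := prodExp_prod (fun i => berWeight (q i))
    (fun z b => (if z = i then berCentered (q z) b else 1) * (if z = k then berCentered (q z) b else 1))
  simp only [Finset.prod_mul_distrib, Finset.prod_ite_eq', Finset.mem_univ, if_true] at h
  rw [h]
  refine Finset.prod_eq_zero (Finset.mem_univ i) ?_
  simp [hik, berWeight, berCentered]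
  ring

/-- The product of tilted factors is at most `e⁶` times the product of the bounds on the
distinguished factors. -/
theorem prod_abs_le_of_tilted {s : I → ℝ} {S : Finset I} {B : I → ℝ} (hup : u * p * Fintype.card I ≤ 1)
    (hpos : 0 ≤ p)
    (hs : ∀ z, z ∉ S → |s z| ≤ Real.exp (6 * u * p)) (hsS : ∀ z ∈ S, |s z| ≤ B z)
    (hu0 : 0 ≤ u) : |∏ z, s z| ≤ Real.exp 6 * ∏ z ∈ S, B z := by
  have hB : ∀ z ∈ S, 0 ≤ B z := fun z hz => (abs_nonneg _).trans (hsS z hz)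
  have he : 1 ≤ Real.exp (6 * u * p) := Real.one_le_exp (by positivity)
  have hE : (∏ _z : I, Real.exp (6 * u * p)) ≤ Real.exp 6 := by
    rw [Finset.prod_const, ← Real.exp_nat_mul, Finset.card_univ]
    exact Real.exp_le_exp.2 (by nlinarith)
  rw [Finset.abs_prod]
  calc ∏ z, |s z| ≤ ∏ z, (Real.exp (6 * u * p) * if z ∈ S then B z else 1) := by
        refine Finset.prod_le_prod (fun z _ => abs_nonneg _) fun z _ => ?_
        split_ifs with hz
        · exact (hsS z hz).trans (le_mul_of_one_le_left (hB z hz) he)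
        · simpa using hs z hz
    _ = (∏ _z : I, Real.exp (6 * u * p)) * ∏ z ∈ S, B z := by
        rw [Finset.prod_mul_distrib, Finset.prod_ite_mem, Finset.univ_inter]
    _ ≤ _ := mul_le_mul_of_nonneg_right hE (Finset.prod_nonneg hB)

include h0 h1 hp hu0 hu1 in
-- The tilt factorizes over coordinates. Index i contributes a second moment, at most 6 p. If l = k,
-- that index contributes another 6 p; otherwise l and k each contribute a first moment, at most 6 u
-- p. The remaining coordinates are pure tilted masses, whose product is at most exp(6 u p |I|) ≤
-- exp 6.
theorem abs_tilted_fourth_moment_le (hup : u * p * Fintype.card I ≤ 1) {i l k : I} (hil : i ≠ l)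
    (hik : i ≠ k) :
    |prodExp (fun i => berWeight (q i)) (fun c => Real.exp (u * ∑ z, berCentered (q z) (c z) ^ 2) *
      (berCentered (q i) (c i) ^ 2 * berCentered (q l) (c l) * berCentered (q k) (c k)))| ≤
      Real.exp 6 * (36 * p ^ 2 * (if l = k then 1 else 0) + 216 * u ^ 2 * p ^ 3) := by
  have hp0 : 0 ≤ p := by have := h0 i; have := hp i; linarith
  set g : I → Bool → ℝ := fun z b => Real.exp (u * berCentered (q z) b ^ 2) *
    ((if z = i then berCentered (q z) b ^ 2 else 1) * (if z = l then berCentered (q z) b else 1) *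
      (if z = k then berCentered (q z) b else 1)) with hg
  have h := prodExp_prod (fun i => berWeight (q i)) g
  have e : ∀ c : I → Bool, ∏ z, g z (c z) = Real.exp (u * ∑ z, berCentered (q z) (c z) ^ 2) *
      (berCentered (q i) (c i) ^ 2 * berCentered (q l) (c l) * berCentered (q k) (c k)) := by
    intro c
    simp only [hg, Finset.prod_mul_distrib, Finset.prod_ite_eq', Finset.mem_univ, if_true,
      ← Real.exp_sum, ← Finset.mul_sum]
  simp only [e] at h
  rw [h]
  have hmass : ∀ z, |∑ b, berWeight (q z) b * Real.exp (u * berCentered (q z) b ^ 2)| ≤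
      Real.exp (6 * u * p) := fun z => by
    rw [abs_of_nonneg (zero_le_one.trans (one_le_tilted_mass (h0 z) (h1 z) hu0))]
    exact tilted_mass_le (h0 z) (h1 z) (hp z) hu0 hu1
  have hsec : ∀ z, |∑ b, berWeight (q z) b *
      (Real.exp (u * berCentered (q z) b ^ 2) * berCentered (q z) b ^ 2)| ≤ 6 * p := fun z => by
    rw [abs_of_nonneg]
    · exact tilted_second_moment_le (h0 z) (h1 z) (hp z) hu0 hu1
    · exact Finset.sum_nonneg fun b _ => mul_nonneg (berWeight_nonneg (h0 z) (h1 z) b)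
        (by positivity)
  by_cases hlk : l = k
  · subst hlk
    have hle := prod_abs_le_of_tilted (S := {i, l}) (B := fun _ => 6 * p)
      (s := fun z => ∑ b, berWeight (q z) b * g z b) hup hp0 ?_ ?_ hu0
    · refine hle.trans (mul_le_mul_of_nonneg_left ?_ (Real.exp_pos _).le)
      rw [Finset.prod_pair hil]
      simp only [if_true]
      have : 0 ≤ 216 * u ^ 2 * p ^ 3 := by positivity
      nlinarith
    · intro z hz
      simp only [Finset.mem_insert, Finset.mem_singleton, not_or] at hz
      simpa [hg, hz.1, hz.2] using hmass z
    · intro z hz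
      simp only [Finset.mem_insert, Finset.mem_singleton] at hz
      rcases hz with rfl | rfl
      · simpa [hg, hil] using hsec z
      · simpa [hg, hil.symm, sq] using hsec z
  · have hle := prod_abs_le_of_tilted (S := {i, l, k})
      (B := fun z => if z = i then 6 * p else 6 * u * p)
      (s := fun z => ∑ b, berWeight (q z) b * g z b) hup hp0 ?_ ?_ hu0
    · refine hle.trans (mul_le_mul_of_nonneg_left ?_ (Real.exp_pos _).le)
      rw [Finset.prod_insert (by simp [hil, hik]), Finset.prod_pair hlk]
      simp only [if_true, hlk, if_false, hil.symm, hik.symm]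
      nlinarith
    · intro z hz
      simp only [Finset.mem_insert, Finset.mem_singleton, not_or] at hz
      simpa [hg, hz.1, hz.2.1, hz.2.2] using hmass z
    · intro z hz
      simp only [Finset.mem_insert, Finset.mem_singleton] at hz
      rcases hz with rfl | rfl | rfl
      · simpa [hg, hil, hik] using hsec z
      · simpa [hg, hil.symm, hlk] using
          abs_tilted_first_moment_le (h0 z) (h1 z) (hp z) hu0 hu1
      · simpa [hg, hik.symm, Ne.symm hlk] using
          abs_tilted_first_moment_le (h0 z) (h1 z) (hp z) hu0 hu1

end Column

/-! ### The matrix moment generating function of one column -/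

section ColumnMGF

variable {I : Type*} [Fintype I]

theorem sq_sum_abs_le (x : I → ℝ) : (∑ i, |x i|) ^ 2 ≤ Fintype.card I * ∑ i, x i ^ 2 := by
  have h := sq_sum_le_card_mul_sum_sq (s := (Finset.univ : Finset I)) (f := fun i => |x i|)
  simpa [Finset.card_univ] using h

variable [DecidableEq I] {q : I → ℝ} {p u : ℝ} (h0 : ∀ i, 0 ≤ q i) (h1 : ∀ i, q i ≤ 1) (hp : ∀ i, q i ≤ 2 * p)
  (hp0 : 0 ≤ p)

include h0 h1 hp hp0 in
theorem prodExp_exp_mul_offDiagGram_sq_le (hu0 : 0 ≤ u) (hu1 : u ≤ 1)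
    (hup : u * p * Fintype.card I ≤ 1) (x : I → ℝ) :
    prodExp (fun i => berWeight (q i)) (fun c => Real.exp (u * ∑ z, berCentered (q z) (c z) ^ 2) *
      ((offDiagGram (fun i => berCentered (q i) (c i)) *ᵥ x) ⬝ᵥ
        (offDiagGram (fun i => berCentered (q i) (c i)) *ᵥ x))) ≤
      252 * Real.exp 6 * p ^ 2 * Fintype.card I * (x ⬝ᵥ x) := by
  have hterm : ∀ i l k, prodExp (fun i => berWeight (q i)) (fun c =>
      Real.exp (u * ∑ z, berCentered (q z) (c z) ^ 2) *
      (if i = l ∨ i = k then 0 else berCentered (q i) (c i) ^ 2 * berCentered (q l) (c l) *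
        berCentered (q k) (c k) * (x l * x k))) ≤
      Real.exp 6 * (36 * p ^ 2 * (if l = k then x l ^ 2 else 0) +
        216 * u ^ 2 * p ^ 3 * (|x l| * |x k|)) := by
    intro i l k
    have hrhs : 0 ≤ Real.exp 6 * (36 * p ^ 2 * (if l = k then x l ^ 2 else 0) +
        216 * u ^ 2 * p ^ 3 * (|x l| * |x k|)) := by
      have : 0 ≤ (if l = k then x l ^ 2 else 0) := by split_ifs <;> positivity
      positivity
    by_cases h : i = l ∨ i = k
    · simp only [h, if_true, mul_zero]
      simpa [prodExp] using hrhs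
    · simp only [h, if_false]
      push Not at h
      have hm := abs_tilted_fourth_moment_le h0 h1 hp hu0 hu1 hup h.1 h.2
      set m := prodExp (fun i => berWeight (q i)) (fun c =>
        Real.exp (u * ∑ z, berCentered (q z) (c z) ^ 2) *
        (berCentered (q i) (c i) ^ 2 * berCentered (q l) (c l) * berCentered (q k) (c k))) with hmdef
      have e : prodExp (fun i => berWeight (q i)) (fun c =>
          Real.exp (u * ∑ z, berCentered (q z) (c z) ^ 2) *
          (berCentered (q i) (c i) ^ 2 * berCentered (q l) (c l) * berCentered (q k) (c k) *
            (x l * x k))) = (x l * x k) * m := by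
        rw [hmdef, ← prodExp_const_mul]
        congr 1
        funext c
        ring
      rw [e]
      have h2 : (x l * x k) * m ≤ (|x l| * |x k|) * |m| := by
        rw [← abs_mul, ← abs_mul]; exact le_abs_self _
      refine h2.trans ((mul_le_mul_of_nonneg_left hm (by positivity)).trans_eq ?_)
      split_ifs with hlk
      · subst hlk
        rw [abs_mul_abs_self]; ring
      · ring
  have hsum : ∀ c : I → Bool, Real.exp (u * ∑ z, berCentered (q z) (c z) ^ 2) *
      ((offDiagGram (fun i => berCentered (q i) (c i)) *ᵥ x) ⬝ᵥ
        (offDiagGram (fun i => berCentered (q i) (c i)) *ᵥ x)) =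
      ∑ i, ∑ l, ∑ k, Real.exp (u * ∑ z, berCentered (q z) (c z) ^ 2) *
      (if i = l ∨ i = k then 0 else berCentered (q i) (c i) ^ 2 * berCentered (q l) (c l) *
        berCentered (q k) (c k) * (x l * x k)) := by
    intro c
    rw [offDiagGram_mulVec_sq]
    simp only [Finset.mul_sum]
  simp only [hsum, prodExp_sum]
  have hcs := sq_sum_abs_le x
  have hx : 0 ≤ ∑ i, x i ^ 2 := Finset.sum_nonneg fun i _ => sq_nonneg _
  calc _ ≤ ∑ i : I, ∑ l, ∑ k, Real.exp 6 * (36 * p ^ 2 * (if l = k then x l ^ 2 else 0) +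
        216 * u ^ 2 * p ^ 3 * (|x l| * |x k|)) :=
        Finset.sum_le_sum fun i _ => Finset.sum_le_sum fun l _ => Finset.sum_le_sum fun k _ =>
          hterm i l k
    _ = Fintype.card I * (Real.exp 6 * (36 * p ^ 2 * ∑ i, x i ^ 2 +
          216 * u ^ 2 * p ^ 3 * (∑ i, |x i|) ^ 2)) := by
        rw [Finset.sum_const, Finset.card_univ, nsmul_eq_mul, sq (∑ i, |x i|), Finset.sum_mul_sum]
        simp only [← Finset.mul_sum, Finset.sum_add_distrib, Finset.sum_ite_eq, Finset.mem_univ,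
          if_true]
    _ ≤ Fintype.card I * (Real.exp 6 * (36 * p ^ 2 * ∑ i, x i ^ 2 +
          216 * p ^ 2 * ∑ i, x i ^ 2)) := by
        -- Cauchy–Schwarz on the sum of |x i| costs a factor |I|, paid for by u (u p |I|) ≤ 1. Then
        -- 36 + 216 = 252.
        gcongr Fintype.card I * (Real.exp 6 * (36 * p ^ 2 * ∑ i, x i ^ 2 + ?_))
        have h3 : 216 * u ^ 2 * p ^ 3 * (∑ i, |x i|) ^ 2 ≤
            216 * u ^ 2 * p ^ 3 * (Fintype.card I * ∑ i, x i ^ 2) :=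
          mul_le_mul_of_nonneg_left hcs (by positivity)
        have h4 : u * (u * p * Fintype.card I) ≤ 1 := mul_le_one₀ hu1 (by positivity) hup
        have h5 : 216 * u ^ 2 * p ^ 3 * (Fintype.card I * ∑ i, x i ^ 2) =
          (u * (u * p * Fintype.card I)) * (216 * p ^ 2 * ∑ i, x i ^ 2) := by ring
        rw [h5] at h3
        exact h3.trans (mul_le_of_le_one_left (by positivity) h4)
    _ = _ := by rw [dotProduct_self_eq]; ring

include h0 h1 hp hp0 in
/-- The matrix moment generating function of the hollowed Gram matrix of one column. -/
theorem prodExp_exp_offDiagGram_le {θ : ℝ} (hθ : |θ| ≤ 1) (hup : |θ| * p * Fintype.card I ≤ 1)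
    (x : I → ℝ) :
    prodExp (fun i => berWeight (q i)) (fun c =>
      x ⬝ᵥ (NormedSpace.exp (θ • offDiagGram (fun i => berCentered (q i) (c i))) *ᵥ x)) ≤
      (1 + 252 * Real.exp 6 * θ ^ 2 * p ^ 2 * Fintype.card I) * (x ⬝ᵥ x) := by
  have hw : ∀ i b, 0 ≤ berWeight (q i) b := fun i b => berWeight_nonneg (h0 i) (h1 i) b
  set X : (I → Bool) → Matrix I I ℝ := fun c => offDiagGram (fun i => berCentered (q i) (c i))
    with hX
  -- The random norm bound |θ| |w|² of the summand enters through its exponential, which is the tilt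
  -- with u = |θ|.
  have hbound : ∀ c, x ⬝ᵥ (NormedSpace.exp (θ • X c) *ᵥ x) ≤
      (x ⬝ᵥ x + θ * (x ⬝ᵥ (X c *ᵥ x))) + θ ^ 2 *
        (Real.exp (|θ| * ∑ z, berCentered (q z) (c z) ^ 2) * ((X c *ᵥ x) ⬝ᵥ (X c *ᵥ x))) := by
    intro c
    have hf : FormBound (θ • X c) (|θ| * ∑ z, berCentered (q z) (c z) ^ 2) := by
      intro y
      have := formBound_offDiagGram (fun i => berCentered (q i) (c i)) y
      rw [smul_mulVec, dotProduct_smul, smul_eq_mul, abs_mul, mul_assoc]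
      exact mul_le_mul_of_nonneg_left this (abs_nonneg _)
    have := dotProduct_exp_mulVec_le ((offDiagGram_isSymm _).smul θ) hf x
    rw [smul_mulVec, dotProduct_smul, dotProduct_smul, smul_dotProduct] at this
    simp only [smul_eq_mul] at this
    linarith
  -- Without the diagonal, only products of distinct independent centered entries remain.
  have hmean : prodExp (fun i => berWeight (q i)) (fun c => x ⬝ᵥ (X c *ᵥ x)) = 0 := by
    have e : ∀ c : I → Bool, x ⬝ᵥ (X c *ᵥ x) = ∑ i, ∑ k, (if i = k then 0 else x i * x k) *
        (berCentered (q i) (c i) * berCentered (q k) (c k)) := by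
      intro c
      simp only [dotProduct, hX, offDiagGram_mulVec, Finset.mul_sum]
      refine Finset.sum_congr rfl fun i _ => Finset.sum_congr rfl fun k _ => ?_
      split_ifs <;> ring
    simp only [e, prodExp_sum, prodExp_const_mul]
    refine Finset.sum_eq_zero fun i _ => Finset.sum_eq_zero fun k _ => ?_
    by_cases h : i = k
    · simp [h]
    · rw [prodExp_berCentered_mul h, mul_zero]
  refine (prodExp_mono hw hbound).trans ?_
  rw [prodExp_add, prodExp_add, prodExp_const (fun i => sum_berWeight _), prodExp_const_mul,
    prodExp_const_mul, hmean, mul_zero, add_zero]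
  have := prodExp_exp_mul_offDiagGram_sq_le h0 h1 hp hp0 (abs_nonneg θ) hθ hup x
  have := mul_le_mul_of_nonneg_left this (sq_nonneg θ)
  linarith

end ColumnMGF

/-! ### Probabilities under finite product weights -/

section ProductProbability

variable {ι Ω : Type*} [Fintype ι] [DecidableEq ι] [Fintype Ω]

open Classical in
/-- The probability of an event under product weights. -/
noncomputable def prodProb (w : ι → Ω → ℝ) (P : (ι → Ω) → Prop) : ℝ :=
  prodExp w (fun f => if P f then 1 else 0)

theorem prodProb_mono {w : ι → Ω → ℝ} (hw : ∀ i a, 0 ≤ w i a) {P Q : (ι → Ω) → Prop}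
    (h : ∀ f, P f → Q f) : prodProb w P ≤ prodProb w Q := by
  refine prodExp_mono hw fun f => ?_
  by_cases hP : P f
  · simp [hP, h f hP]
  · by_cases hQ : Q f <;> simp [hP, hQ]

theorem prodProb_or_le {w : ι → Ω → ℝ} (hw : ∀ i a, 0 ≤ w i a) (P Q : (ι → Ω) → Prop) :
    prodProb w (fun f => P f ∨ Q f) ≤ prodProb w P + prodProb w Q := by
  unfold prodProb
  rw [← prodExp_add]
  refine prodExp_mono hw fun f => ?_
  by_cases hP : P f <;> by_cases hQ : Q f <;> simp [hP, hQ]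

theorem prodProb_le_div {w : ι → Ω → ℝ} (hw : ∀ i a, 0 ≤ w i a) {F : (ι → Ω) → ℝ}
    (hF : ∀ f, 0 ≤ F f) {t : ℝ} (ht : 0 < t) :
    prodProb w (fun f => t ≤ F f) ≤ prodExp w F / t :=
  prodExp_indicator_le hw hF ht

end ProductProbability

/-! ### Tail bound for the hollowed noise Gram matrix -/

section HollowTail

variable {I : Type*} [DecidableEq I] {m : ℕ}

/-- The off-diagonal part of `W Wᵀ`, where `W` is the matrix of centered Bernoulli entries. -/
noncomputable def noiseGram (q : I × Fin m → ℝ) (G : I × Fin m → Bool) : Matrix I I ℝ :=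
  ∑ j, offDiagGram (fun i => berCentered (q (i, j)) (G (i, j)))

theorem noiseGram_isSymm (q : I × Fin m → ℝ) (G : I × Fin m → Bool) : (noiseGram q G).IsSymm := by
  rw [IsSymm, noiseGram, transpose_sum]
  exact Finset.sum_congr rfl fun j _ => offDiagGram_isSymm _

variable [Fintype I]

theorem prodExp_trace_exp_noiseGram_le {q : I × Fin m → ℝ} {p θ : ℝ} (h0 : ∀ x, 0 ≤ q x)
    (h1 : ∀ x, q x ≤ 1) (hp : ∀ x, q x ≤ 2 * p) (hp0 : 0 ≤ p) (hθ : |θ| ≤ 1)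
    (hup : |θ| * p * Fintype.card I ≤ 1) :
    prodExp (fun x => berWeight (q x)) (fun G => trace (NormedSpace.exp (θ • noiseGram q G))) ≤
      Fintype.card I * Real.exp (252 * Real.exp 6 * θ ^ 2 * p ^ 2 * Fintype.card I * m) := by
  set κ : ℝ := 1 + 252 * Real.exp 6 * θ ^ 2 * p ^ 2 * Fintype.card I with hκ
  have hκ0 : 0 ≤ κ := by positivity
  have hw : ∀ x b, 0 ≤ berWeight (q x) b := fun x b => berWeight_nonneg (h0 x) (h1 x) b
  rw [prodExp_curry]
  have h := prodExp_trace_exp_add_sum_le (fun j (c : I → Bool) => ∏ i, berWeight (q (i, j)) (c i))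
    (fun j c => Finset.prod_nonneg fun i _ => hw _ _)
    (fun j c => θ • offDiagGram (fun i => berCentered (q (i, j)) (c i)))
    (fun j c => (offDiagGram_isSymm _).smul θ) hκ0
    (fun j x => prodExp_exp_offDiagGram_le (fun i => h0 (i, j)) (fun i => h1 (i, j))
      (fun i => hp (i, j)) hp0 hθ hup x) (S := 0) (by simp [IsSymm])
  simp only [zero_add, ← Finset.smul_sum, NormedSpace.exp_zero, trace_one] at h
  refine (h.trans_eq (mul_comm _ _)).trans (mul_le_mul_of_nonneg_left ?_ (by positivity))
  rw [mul_comm _ (m : ℝ), Real.exp_nat_mul]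
  refine pow_le_pow_left₀ hκ0 ?_ m
  rw [hκ, add_comm]
  exact Real.add_one_le_exp _

/-- Markov's inequality for the trace exponential at θ and at -θ, one for each side of the form
bound; hence the factor 2. -/
theorem prodProb_not_formBound_noiseGram_le {q : I × Fin m → ℝ} {p θ t : ℝ} (h0 : ∀ x, 0 ≤ q x)
    (h1 : ∀ x, q x ≤ 1) (hp : ∀ x, q x ≤ 2 * p) (hp0 : 0 ≤ p) (hθ0 : 0 < θ) (hθ : θ ≤ 1)
    (hup : θ * p * Fintype.card I ≤ 1) :
    prodProb (fun x => berWeight (q x)) (fun G => ¬ FormBound (noiseGram q G) t) ≤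
      2 * Fintype.card I *
        Real.exp (252 * Real.exp 6 * θ ^ 2 * p ^ 2 * Fintype.card I * m - θ * t) := by
  have hw : ∀ x b, 0 ≤ berWeight (q x) b := fun x b => berWeight_nonneg (h0 x) (h1 x) b
  have hone : ∀ θ' : ℝ, |θ'| = θ → prodProb (fun x => berWeight (q x)) (fun G =>
      Real.exp (θ * t) ≤ trace (NormedSpace.exp (θ' • noiseGram q G))) ≤ Fintype.card I *
        Real.exp (252 * Real.exp 6 * θ ^ 2 * p ^ 2 * Fintype.card I * m - θ * t) := by
    intro θ' hθ'
    refine (prodProb_le_div hw (fun G => ?_) (Real.exp_pos _)).trans ?_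
    · have hs : (NormedSpace.exp ((2 : ℝ)⁻¹ • θ' • noiseGram q G)).IsSymm :=
        IsSymm.exp (((noiseGram_isSymm q G).smul θ').smul _)
      have := trace_mul_transpose_nonneg (NormedSpace.exp ((2 : ℝ)⁻¹ • θ' • noiseGram q G))
      rw [hs.eq, ← sq, ← Matrix.exp_nsmul, ← Nat.cast_smul_eq_nsmul ℝ, smul_smul] at this
      norm_num at this
      exact this
    · rw [div_le_iff₀ (Real.exp_pos _), mul_assoc, ← Real.exp_add, sub_add_cancel]
      have := prodExp_trace_exp_noiseGram_le h0 h1 hp hp0 (θ := θ') (by rw [hθ']; exact hθ)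
        (by rw [hθ']; exact hup)
      rwa [← sq_abs, hθ'] at this
  have himp : ∀ G, ¬ FormBound (noiseGram q G) t →
      (Real.exp (θ * t) ≤ trace (NormedSpace.exp (θ • noiseGram q G)) ∨
        Real.exp (θ * t) ≤ trace (NormedSpace.exp ((-θ) • noiseGram q G))) := by
    intro G hG
    by_contra hc
    push Not at hc
    refine hG fun x => ?_
    have a1 := dotProduct_mulVec_le_of_trace_exp_lt ((noiseGram_isSymm q G).smul θ) hc.1 x
    have a2 := dotProduct_mulVec_le_of_trace_exp_lt ((noiseGram_isSymm q G).smul (-θ)) hc.2 x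
    rw [smul_mulVec, dotProduct_smul, smul_eq_mul, mul_assoc] at a1 a2
    rw [abs_le]
    have b1 := le_of_mul_le_mul_left a1 hθ0
    have b2 : -(x ⬝ᵥ (noiseGram q G *ᵥ x)) ≤ t * (x ⬝ᵥ x) :=
      le_of_mul_le_mul_left (by linarith) hθ0
    constructor <;> linarith
  refine (prodProb_mono hw himp).trans ((prodProb_or_le hw _ _).trans ?_)
  have c1 := hone θ (abs_of_pos hθ0)
  have c2 := hone (-θ) (by rw [abs_neg, abs_of_pos hθ0])
  linarith

end HollowTail

/-! ### Perturbation of the top eigenvector and sign errors -/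

section FormBound

variable {n : Type*} [Fintype n]

theorem FormBound.add {A B : Matrix n n ℝ} {a b : ℝ} (hA : FormBound A a) (hB : FormBound B b) :
    FormBound (A + B) (a + b) := by
  intro x
  rw [add_mulVec, dotProduct_add, add_mul]
  exact (abs_add_le _ _).trans (add_le_add (hA x) (hB x))

theorem FormBound.smul {A : Matrix n n ℝ} {a : ℝ} (hA : FormBound A a) (c : ℝ) :
    FormBound (c • A) (|c| * a) := by
  intro x
  rw [smul_mulVec, dotProduct_smul, smul_eq_mul, abs_mul, mul_assoc]
  exact mul_le_mul_of_nonneg_left (hA x) (abs_nonneg _)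

theorem FormBound.mono {A : Matrix n n ℝ} {a b : ℝ} (hA : FormBound A a) (h : a ≤ b) :
    FormBound A b := fun x => (hA x).trans
  (mul_le_mul_of_nonneg_right h (by rw [dotProduct_self_eq]; positivity))

/-- The quadratic-form bound controls the bilinear form of a symmetric matrix. -/
theorem FormBound.sq_dotProduct_mulVec_le {E : Matrix n n ℝ} (hE : E.IsSymm) {ε : ℝ}
    (h : FormBound E ε) (w v : n → ℝ) :
    (w ⬝ᵥ (E *ᵥ v)) ^ 2 ≤ ε ^ 2 * ((w ⬝ᵥ w) * (v ⬝ᵥ v)) := by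
  have hsymm : v ⬝ᵥ (E *ᵥ w) = w ⬝ᵥ (E *ᵥ v) := by
    rw [dotProduct_mulVec, ← mulVec_transpose, hE.eq, dotProduct_comm]
  -- Polarization: the bounds at w + t v and w - t v combine into a quadratic in t that is
  -- nonnegative everywhere, and its discriminant gives the claim.
  have key : ∀ t : ℝ, 0 ≤ (ε * (v ⬝ᵥ v)) * (t * t) + (-2 * (w ⬝ᵥ (E *ᵥ v))) * t
      + ε * (w ⬝ᵥ w) := by
    intro t
    have h1 := (abs_le.1 (h (w + t • v))).2
    have h2 := (abs_le.1 (h (w - t • v))).1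
    simp only [mulVec_add, mulVec_sub, mulVec_smul, dotProduct_add, dotProduct_sub, add_dotProduct,
      sub_dotProduct, smul_dotProduct, dotProduct_smul, smul_eq_mul, hsymm,
      dotProduct_comm v w] at h1 h2
    linarith
  have := discrim_le_zero key
  rw [discrim] at this
  nlinarith

end FormBound

theorem IsTopEigenvector.exists_rayleigh {n : ℕ} {M : Matrix (Fin n) (Fin n) ℝ} {v : Fin n → ℝ}
    (h : IsTopEigenvector M v) (hM : M.IsSymm) :
    ∃ μ : ℝ, M *ᵥ v = μ • v ∧ v ≠ 0 ∧ ∀ x : Fin n → ℝ, x ⬝ᵥ (M *ᵥ x) ≤ μ * (x ⬝ᵥ x) := by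
  obtain ⟨μ, hv, hmax⟩ := h
  refine ⟨μ, by simpa using hv.apply_eq_smul, hv.2, fun x => ?_⟩
  obtain ⟨U, d, h1, h2, rfl⟩ := exists_orthogonal_diagonalization hM
  have hd : ∀ i, d i ≤ μ := by
    intro i
    obtain ⟨y, -, hy, hy0⟩ := diagonalization_eigenvalue h1 d i
    refine hmax _ (Module.End.hasEigenvalue_of_hasEigenvector (x := y) ⟨?_, hy0⟩)
    rw [Module.End.mem_eigenspace_iff, toLin'_apply, hy]
  rw [dotProduct_conj_diagonal_mulVec, ← dotProduct_orthogonal_mulVec h2 x, dotProduct_self_eq,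
    Finset.mul_sum]
  exact Finset.sum_le_sum fun i _ => mul_le_mul_of_nonneg_right (hd i) (sq_nonneg _)

theorem labelVal_eq (u : ℤˣ) : labelVal u = 1 ∨ labelVal u = -1 := by
  rcases Int.units_eq_one_or u with rfl | rfl <;> simp [labelVal]

theorem labelVal_sq (u : ℤˣ) : labelVal u ^ 2 = 1 := by
  rcases labelVal_eq u with h | h <;> rw [h] <;> norm_num

/-- The labels as a real vector. -/
def labelVec {n : ℕ} (η : Labels n) : Fin n → ℝ := fun i => labelVal (η i)

theorem labelVec_dotProduct_self {n : ℕ} (η : Labels n) : labelVec η ⬝ᵥ labelVec η = n := by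
  rw [dotProduct_self_eq]
  simp [labelVec, labelVal_sq]

/-- A wrong sign, including an arbitrary choice at v = 0, forces v x ≤ 0 and hence |v - a x| ≥ a,
while the error made is exactly 2. -/
theorem abs_sub_le_of_sign {x y a v : ℝ} (hx : x = 1 ∨ x = -1) (hy : y = 1 ∨ y = -1)
    (ha : 0 < a) (hv : v ≠ 0 → y = Real.sign v) : |y - x| ≤ 2 * ((v - a * x) ^ 2 / a ^ 2) := by
  have h0 : 0 ≤ (v - a * x) ^ 2 / a ^ 2 := by positivity
  have h1 : v * x ≤ 0 → 1 ≤ (v - a * x) ^ 2 / a ^ 2 := by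
    intro h
    rw [le_div_iff₀ (by positivity)]
    have : x ^ 2 = 1 := by rcases hx with h | h <;> rw [h] <;> norm_num
    nlinarith [sq_nonneg v]
  have hv1 : 0 < v → y = 1 := fun h => by rw [hv h.ne', Real.sign_of_pos h]
  have hv2 : v < 0 → y = -1 := fun h => by rw [hv h.ne, Real.sign_of_neg h]
  rcases hx with rfl | rfl <;> rcases hy with rfl | rfl
  · simpa using h0
  · have : v * 1 ≤ 0 := by
      by_contra hc
      have := hv1 (by linarith)
      norm_num at this
    have := h1 this
    rw [show |(-1 : ℝ) - 1| = 2 by norm_num]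
    linarith
  · have : v * (-1) ≤ 0 := by
      by_contra hc
      have := hv2 (by linarith)
      norm_num at this
    have := h1 this
    rw [show |(1 : ℝ) - -1| = 2 by norm_num]
    linarith
  · simpa using h0

/-- The sign of a decides which of the two global flips in the loss is used. -/
theorem loss_le_of_sign {n : ℕ} {η e : Labels n} {v : Fin n → ℝ} {a : ℝ} (ha : a ≠ 0)
    (he : ∀ i, v i ≠ 0 → labelVal (e i) = Real.sign (v i)) :
    loss η e ≤ 2 * ((∑ i, (v i - a * labelVal (η i)) ^ 2) / a ^ 2) := by
  rw [Finset.sum_div, Finset.mul_sum]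
  rcases lt_or_gt_of_ne ha with h | h
  · refine (min_le_right _ _).trans (Finset.sum_le_sum fun i _ => ?_)
    have := abs_sub_le_of_sign (x := -labelVal (η i)) (y := labelVal (e i)) (a := -a) (v := v i)
      ?_ (labelVal_eq _) (by linarith) (he i)
    · simpa using this
    · rcases labelVal_eq (η i) with h | h <;> rw [h] <;> norm_num
  · refine (min_le_left _ _).trans (Finset.sum_le_sum fun i _ => ?_)
    exact abs_sub_le_of_sign (labelVal_eq _) (labelVal_eq _) h (he i)

/-- A Davis–Kahan type bound: the signs of a top eigenvector of a perturbation of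
`l (η ηᵀ - 1)` recover `η` up to few errors. -/
theorem loss_lt_of_formBound {n : ℕ} (hn : 0 < n) {η e : Labels n} {v : Fin n → ℝ}
    {E : Matrix (Fin n) (Fin n) ℝ} {l ε α : ℝ} (hE : E.IsSymm)
    (hv : IsTopEigenvector (l • (vecMulVec (labelVec η) (labelVec η) - 1) + E) v)
    (he : ∀ i, v i ≠ 0 → labelVal (e i) = Real.sign (v i))
    (hε : FormBound E ε) (hl : 0 < l) (hα : α ∈ Set.Ioo (0 : ℝ) 1)
    (hsmall : ε ≤ Real.sqrt α / 4 * (l * n)) : loss η e < α * n := by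
  obtain ⟨hα0, hα1⟩ := hα
  have hN : (0 : ℝ) < n := by exact_mod_cast hn
  set h := labelVec η with hh
  have hhh : h ⬝ᵥ h = n := labelVec_dotProduct_self η
  have hMs : (l • (vecMulVec h h - 1) + E).IsSymm := by
    refine IsSymm.add (IsSymm.smul (IsSymm.sub ?_ (by simp [IsSymm])) l) hE
    ext i j; simp [vecMulVec_apply, mul_comm]
  have hMx : ∀ x, (l • (vecMulVec h h - 1) + E) *ᵥ x = (l * (h ⬝ᵥ x)) • h - l • x + E *ᵥ x := by
    intro x
    rw [add_mulVec, smul_mulVec, sub_mulVec, one_mulVec, vecMulVec_mulVec, smul_sub, op_smul_eq_smul,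
      smul_smul]
  obtain ⟨μ, hμ, hv0, hray⟩ := hv.exists_rayleigh hMs
  have hs0 : 0 ≤ Real.sqrt α := Real.sqrt_nonneg _
  have hs2 : Real.sqrt α ^ 2 = α := Real.sq_sqrt hα0.le
  have hs1 : Real.sqrt α ≤ 1 := Real.sqrt_le_one.2 hα1.le
  have hεn := (abs_le.1 (hε h)).1
  have hε0 : 0 ≤ ε := by
    have := (abs_nonneg _).trans (hε h)
    rw [hhh] at this
    exact nonneg_of_mul_nonneg_left this hN
  -- the top eigenvalue
  have hgap : l * n - ε ≤ μ + l := by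
    have h1 := hray h
    rw [hMx, dotProduct_add, dotProduct_sub, dotProduct_smul, dotProduct_smul, hhh] at h1
    simp only [smul_eq_mul] at h1
    rw [hhh] at hεn
    have : (l * n - ε) * n ≤ (μ + l) * n := by linarith
    exact le_of_mul_le_mul_right this hN
  have hLpos : 0 < l * n := by positivity
  -- Here ε ≤ l n / 4 because √α ≤ 1. The shift from μ to μ + l undoes the -1 in the hollowed
  -- signal.
  have hgap' : 3 / 4 * (l * n) ≤ μ + l := by nlinarith
  -- the component orthogonal to `h`
  set a : ℝ := (h ⬝ᵥ v) / n with ha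
  have han : h ⬝ᵥ v = a * n := by rw [ha]; field_simp
  set w : Fin n → ℝ := v - a • h with hw
  have hvw : v = a • h + w := by rw [hw]; abel
  have hhw : h ⬝ᵥ w = 0 := by
    rw [hw, dotProduct_sub, dotProduct_smul, hhh, han]; simp
  have hwh : w ⬝ᵥ h = 0 := by rw [dotProduct_comm]; exact hhw
  have hwv : w ⬝ᵥ v = w ⬝ᵥ w := by
    conv_lhs => rw [hvw]
    rw [dotProduct_add, dotProduct_smul, hwh]; simp
  have hvv : v ⬝ᵥ v = a ^ 2 * n + w ⬝ᵥ w := by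
    have : v ⬝ᵥ v = a * (h ⬝ᵥ v) + w ⬝ᵥ v := by
      conv_lhs => rw [hvw]
      rw [add_dotProduct, smul_dotProduct, ← hvw]; rfl
    rw [this, hwv, han]; ring
  -- Pairing the eigenvector equation with w, orthogonal to h, kills the rank-one signal.
  have heq : (μ + l) * (w ⬝ᵥ w) = w ⬝ᵥ (E *ᵥ v) := by
    have h1 := congrArg (fun z => w ⬝ᵥ z) hμ
    simp only [hMx, dotProduct_add, dotProduct_sub, dotProduct_smul, hwh, hwv, smul_eq_mul] at h1
    linarith
  have hww0 : 0 ≤ w ⬝ᵥ w := by rw [dotProduct_self_eq]; positivity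
  have hvvpos : 0 < v ⬝ᵥ v := by
    rw [dotProduct_self_eq]
    obtain ⟨i, hi⟩ := Function.ne_iff.1 hv0
    exact Finset.sum_pos' (fun i _ => sq_nonneg _) ⟨i, Finset.mem_univ _, by
      simp only [Pi.zero_apply] at hi; positivity⟩
  have hbil := hε.sq_dotProduct_mulVec_le hE w v
  rw [← heq] at hbil
  -- The ratio of ε² ≤ α/16 (l n)² to (μ + l)² ≥ 9/16 (l n)² is at most α/9.
  have hwle : 9 * (w ⬝ᵥ w) ≤ α * (v ⬝ᵥ v) := by
    rcases hww0.eq_or_lt with hz | hpos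
    · rw [← hz]; simp; positivity
    · have h1 : (μ + l) ^ 2 * (w ⬝ᵥ w) ≤ ε ^ 2 * (v ⬝ᵥ v) := by
        have : ((μ + l) ^ 2 * (w ⬝ᵥ w)) * (w ⬝ᵥ w) ≤ (ε ^ 2 * (v ⬝ᵥ v)) * (w ⬝ᵥ w) := by
          linarith
        exact le_of_mul_le_mul_right this hpos
      have h2 : (3 / 4 * (l * n)) ^ 2 ≤ (μ + l) ^ 2 := pow_le_pow_left₀ (by positivity) hgap' 2
      have h3 : ε ^ 2 ≤ (Real.sqrt α / 4 * (l * n)) ^ 2 := pow_le_pow_left₀ hε0 hsmall 2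
      have h4 : (Real.sqrt α / 4 * (l * n)) ^ 2 = α / 16 * (l * n) ^ 2 := by
        rw [mul_pow, div_pow, hs2]; norm_num
      rw [h4] at h3
      have h5 := mul_le_mul_of_nonneg_right h2 hww0
      have h6 := mul_le_mul_of_nonneg_right h3 hvvpos.le
      have h7 : (l * n) ^ 2 * (9 * (w ⬝ᵥ w)) ≤ (l * n) ^ 2 * (α * (v ⬝ᵥ v)) := by linarith
      exact le_of_mul_le_mul_left h7 (by positivity)
  rw [hvv] at hwle hvvpos
  -- Absorbing α |w|² on the left leaves 9 - α ≥ 8.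
  have hww8 : 8 * (w ⬝ᵥ w) ≤ α * (a ^ 2 * n) := by nlinarith
  have ha0 : a ≠ 0 := by
    intro h0
    rw [h0] at hww8 hvvpos
    norm_num at hww8 hvvpos
    linarith
  have ha2 : 0 < a ^ 2 := by positivity
  have hloss := loss_le_of_sign (η := η) ha0 he
  have hsum : ∑ i, (v i - a * labelVal (η i)) ^ 2 = w ⬝ᵥ w := by
    rw [dotProduct_self_eq]; rfl
  rw [hsum] at hloss
  have : w ⬝ᵥ w / a ^ 2 ≤ α * n / 8 := by
    rw [div_le_iff₀ ha2]; linarith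
  have : 0 < α * n := by positivity
  linarith

/-! ### Form bounds for hollowed rank-two matrices -/

section HollowSym

variable {n : Type*}

section CauchySchwarz

variable [Fintype n]

theorem abs_dotProduct_le_sqrt (a x : n → ℝ) :
    |a ⬝ᵥ x| ≤ Real.sqrt (a ⬝ᵥ a) * Real.sqrt (x ⬝ᵥ x) := by
  rw [← Real.sqrt_mul (by rw [dotProduct_self_eq]; positivity)]
  refine Real.abs_le_sqrt ?_
  rw [dotProduct_self_eq, dotProduct_self_eq]
  exact Finset.sum_mul_sq_le_sq_mul_sq _ _ _

theorem abs_le_sqrt_dotProduct_self (a : n → ℝ) (i : n) : |a i| ≤ Real.sqrt (a ⬝ᵥ a) := by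
  refine Real.abs_le_sqrt ?_
  rw [dotProduct_self_eq]
  exact Finset.single_le_sum (f := fun i => a i ^ 2) (fun i _ => sq_nonneg _) (Finset.mem_univ i)

end CauchySchwarz

variable [DecidableEq n]

/-- The off-diagonal part of `a bᵀ + b aᵀ`. -/
def hollowSym (a b : n → ℝ) : Matrix n n ℝ :=
  Matrix.of fun i k => if i = k then 0 else a i * b k + b i * a k

theorem hollowSym_isSymm (a b : n → ℝ) : (hollowSym a b).IsSymm := by
  ext i k
  by_cases h : i = k
  · simp [hollowSym, h]
  · simp only [hollowSym, transpose_apply, of_apply, h, Ne.symm h, if_false]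
    ring

variable [Fintype n]

theorem dotProduct_hollowSym_mulVec (a b x : n → ℝ) :
    x ⬝ᵥ (hollowSym a b *ᵥ x) =
      2 * ((a ⬝ᵥ x) * (b ⬝ᵥ x)) - 2 * ∑ i, a i * b i * x i ^ 2 := by
  have h : ∀ i, (hollowSym a b *ᵥ x) i =
      a i * (b ⬝ᵥ x) + b i * (a ⬝ᵥ x) - 2 * (a i * b i * x i) := by
    intro i
    have e : ∀ k, hollowSym a b i k * x k = (a i * (b k * x k) + b i * (a k * x k)) -
        if i = k then (a i * b k + b i * a k) * x k else 0 := by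
      intro k
      by_cases h : i = k <;> simp [hollowSym, h]
      all_goals ring
    rw [mulVec, dotProduct]
    simp only [e, Finset.sum_sub_distrib, Finset.sum_add_distrib, ← Finset.mul_sum,
      Finset.sum_ite_eq, Finset.mem_univ, if_true]
    simp only [dotProduct]
    ring
  rw [dotProduct]
  simp only [h]
  calc _ = ∑ i, (((b ⬝ᵥ x) * (a i * x i) + (a ⬝ᵥ x) * (b i * x i)) - 2 * (a i * b i * x i ^ 2)) :=
        Finset.sum_congr rfl fun i _ => by ring
    _ = _ := by
        rw [Finset.sum_sub_distrib, Finset.sum_add_distrib, ← Finset.mul_sum, ← Finset.mul_sum,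
          ← Finset.mul_sum]
        change (b ⬝ᵥ x) * (a ⬝ᵥ x) + (a ⬝ᵥ x) * (b ⬝ᵥ x) - _ = _
        ring

/-- Half of the constant 4 pays for the rank-two form and half for the removed diagonal. -/
theorem formBound_hollowSym (a b : n → ℝ) :
    FormBound (hollowSym a b) (4 * (Real.sqrt (a ⬝ᵥ a) * Real.sqrt (b ⬝ᵥ b))) := by
  intro x
  set α := Real.sqrt (a ⬝ᵥ a)
  set β := Real.sqrt (b ⬝ᵥ b)
  have hα : 0 ≤ α := Real.sqrt_nonneg _
  have hβ : 0 ≤ β := Real.sqrt_nonneg _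
  have hx : 0 ≤ x ⬝ᵥ x := by rw [dotProduct_self_eq]; positivity
  rw [dotProduct_hollowSym_mulVec]
  have h1 : |(a ⬝ᵥ x) * (b ⬝ᵥ x)| ≤ α * β * (x ⬝ᵥ x) := by
    rw [abs_mul]
    have := mul_le_mul (abs_dotProduct_le_sqrt a x) (abs_dotProduct_le_sqrt b x) (abs_nonneg _)
      (by positivity)
    refine this.trans_eq ?_
    rw [mul_mul_mul_comm, Real.mul_self_sqrt hx]
  have h2 : |∑ i, a i * b i * x i ^ 2| ≤ α * β * (x ⬝ᵥ x) := by
    rw [dotProduct_self_eq, Finset.mul_sum]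
    refine (Finset.abs_sum_le_sum_abs _ _).trans (Finset.sum_le_sum fun i _ => ?_)
    rw [abs_mul, abs_mul, abs_of_nonneg (sq_nonneg (x i))]
    exact mul_le_mul_of_nonneg_right (mul_le_mul (abs_le_sqrt_dotProduct_self a i)
      (abs_le_sqrt_dotProduct_self b i) (abs_nonneg _) hα) (sq_nonneg _)
  rw [abs_le] at h1 h2 ⊢
  constructor <;> linarith [h1.1, h1.2, h2.1, h2.2]

end HollowSym

/-! ### Signal plus perturbation -/

section Decomposition

variable {n₁ n₂ : ℕ}

/-- The probability of an edge in the bipartite stochastic block model. -/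
noncomputable def edgeProb (δ p : ℝ) (η₁ : Labels n₁) (η₂ : Labels n₂) (x : Fin n₁ × Fin n₂) : ℝ :=
  if η₁ x.1 = η₂ x.2 then δ * p else (2 - δ) * p

theorem edgeProb_eq (δ p : ℝ) (η₁ : Labels n₁) (η₂ : Labels n₂) (x : Fin n₁ × Fin n₂) :
    edgeProb δ p η₁ η₂ x = p + (δ - 1) * p * (labelVec η₁ x.1 * labelVec η₂ x.2) := by
  rcases Int.units_eq_one_or (η₁ x.1) with h1 | h1 <;>
    rcases Int.units_eq_one_or (η₂ x.2) with h2 | h2 <;>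
    simp [edgeProb, labelVec, labelVal, h1, h2] <;> ring

/-- The noise matrix `W = A - 𝔼 A`. -/
noncomputable def noise (q : Fin n₁ × Fin n₂ → ℝ) (G : BipGraph n₁ n₂) :
    Matrix (Fin n₁) (Fin n₂) ℝ :=
  Matrix.of fun i j => berCentered (q (i, j)) (G (i, j))

theorem biadj_eq (q : Fin n₁ × Fin n₂ → ℝ) (G : BipGraph n₁ n₂) (i : Fin n₁) (j : Fin n₂) :
    biadj G i j = q (i, j) + noise q G i j := by
  simp [biadj, noise, berCentered]

theorem noiseGram_apply (q : Fin n₁ × Fin n₂ → ℝ) (G : BipGraph n₁ n₂) (i k : Fin n₁) :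
    noiseGram q G i k = if i = k then 0 else ∑ j, noise q G i j * noise q G k j := by
  rw [noiseGram, Matrix.sum_apply]
  by_cases h : i = k <;> simp [offDiagGram, noise, h]

theorem hollow_mul_transpose_apply {n m : ℕ} (B : Matrix (Fin n) (Fin m) ℝ) (i k : Fin n) :
    hollow (B * Bᵀ) i k = if i = k then 0 else ∑ j, B i j * B k j := by
  by_cases h : i = k
  · simp [hollow, h]
  · simp [hollow, h, mul_apply]

/-- The perturbation of the signal in the hollowed Gram matrix; `s = (δ - 1) p` and `D = p̂ - p`. -/
noncomputable def perturbation (q : Fin n₁ × Fin n₂ → ℝ) (η₁ : Labels n₁) (η₂ : Labels n₂)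
    (s D : ℝ) (G : BipGraph n₁ n₂) : Matrix (Fin n₁) (Fin n₁) ℝ :=
  noiseGram q G + s • hollowSym (labelVec η₁) (noise q G *ᵥ labelVec η₂)
    + (-(D * s * ∑ j, labelVec η₂ j)) • hollowSym (labelVec η₁) 1
    -- The off-diagonal entries of `hollowSym 1 1` are 2, whence the division by 2.
    + (-D) • hollowSym 1 (noise q G *ᵥ 1) + (D ^ 2 * n₂ / 2) • hollowSym 1 1

theorem perturbation_isSymm (q : Fin n₁ × Fin n₂ → ℝ) (η₁ : Labels n₁) (η₂ : Labels n₂)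
    (s D : ℝ) (G : BipGraph n₁ n₂) : (perturbation q η₁ η₂ s D G).IsSymm :=
  ((((noiseGram_isSymm q G).add ((hollowSym_isSymm _ _).smul _)).add
    ((hollowSym_isSymm _ _).smul _)).add ((hollowSym_isSymm _ _).smul _)).add
    ((hollowSym_isSymm _ _).smul _)

/-- Off the diagonal this expands the Gram matrix of s η₁ η₂ᵀ + W - D 1 1ᵀ, using that squared
labels are 1. On the diagonal both sides vanish. -/
theorem hollowedGram_eq (δ p : ℝ) (η₁ : Labels n₁) (η₂ : Labels n₂) (G : BipGraph n₁ n₂) :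
    hollowedGram (biadj G) = (((δ - 1) * p) ^ 2 * n₂) •
        (vecMulVec (labelVec η₁) (labelVec η₁) - 1) +
      perturbation (edgeProb δ p η₁ η₂) η₁ η₂ ((δ - 1) * p) (pHat (biadj G) - p) G := by
  set q := edgeProb δ p η₁ η₂ with hq
  set s := (δ - 1) * p with hs
  set D := pHat (biadj G) - p with hD
  have hent : ∀ i j, centered (biadj G) i j =
      s * (labelVec η₁ i * labelVec η₂ j) + noise q G i j - D := by
    intro i j
    rw [centered, Matrix.sub_apply, of_apply, biadj_eq q, hq, edgeProb_eq, hD]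
    ring
  ext i k
  rw [hollowedGram, hollow_mul_transpose_apply]
  by_cases h : i = k
  · subst h
    have : labelVec η₁ i * labelVec η₁ i = 1 := by
      rw [← sq]; exact labelVal_sq _
    simp [perturbation, noiseGram_apply, hollowSym, vecMulVec_apply, this]
  · simp only [h, if_false, perturbation, noiseGram_apply, hollowSym, vecMulVec_apply, Matrix.add_apply,
      Matrix.smul_apply, Matrix.sub_apply, of_apply, one_apply_ne h, smul_eq_mul, Pi.one_apply, mulVec, dotProduct,
      mul_one, one_mul]
    have hsq : ∀ j, labelVec η₂ j ^ 2 = 1 := fun j => labelVal_sq _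
    calc ∑ j, centered (biadj G) i j * centered (biadj G) k j
        = ∑ j, (s ^ 2 * (labelVec η₁ i * labelVec η₁ k) * 1
          + noise q G i j * noise q G k j
          + s * labelVec η₁ i * (noise q G k j * labelVec η₂ j)
          + s * labelVec η₁ k * (noise q G i j * labelVec η₂ j)
          - D * s * (labelVec η₁ i + labelVec η₁ k) * labelVec η₂ j
          - D * noise q G i j - D * noise q G k j + D ^ 2 * 1) := by
          refine Finset.sum_congr rfl fun j _ => ?_
          rw [hent, hent]
          linear_combination (s ^ 2 * (labelVec η₁ i * labelVec η₁ k)) * hsq j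
      _ = _ := by
          simp only [Finset.sum_add_distrib, Finset.sum_sub_distrib, ← Finset.mul_sum,
            Finset.sum_const, Finset.card_univ, Fintype.card_fin, nsmul_eq_mul]
          ring

theorem sum_labelVec_eq {n : ℕ} (η : Labels n) :
    ∑ i, labelVec η i = (labelCount η 1 : ℝ) - labelCount η (-1) := by
  have h : ∀ i, labelVec η i = (if η i = 1 then (1 : ℝ) else 0) - if η i = -1 then 1 else 0 := by
    intro i
    rcases Int.units_eq_one_or (η i) with h | h <;> simp [labelVec, labelVal, h]
  simp only [h, Finset.sum_sub_distrib, labelCount, Finset.sum_boole]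

theorem abs_sum_labelVec_le {n : ℕ} (hn : 0 < n) {η : Labels n} {γ : ℝ} (h : imbalance η ≤ γ) :
    |∑ i, labelVec η i| ≤ γ * n := by
  rw [sum_labelVec_eq]
  rwa [imbalance, div_le_iff₀ (by exact_mod_cast hn)] at h

theorem pHat_biadj_sub (h₁ : 0 < n₁) (h₂ : 0 < n₂) (δ p : ℝ) (η₁ : Labels n₁) (η₂ : Labels n₂)
    (G : BipGraph n₁ n₂) :
    pHat (biadj G) - p = ((δ - 1) * p * ((∑ i, labelVec η₁ i) * ∑ j, labelVec η₂ j) +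
      ∑ i, (noise (edgeProb δ p η₁ η₂) G *ᵥ 1) i) / ((n₁ : ℝ) * n₂) := by
  have hn : (n₁ : ℝ) * n₂ ≠ 0 := by positivity
  have h : ∑ i, ∑ j, biadj G i j = (n₁ : ℝ) * n₂ * p +
      ((δ - 1) * p * ((∑ i, labelVec η₁ i) * ∑ j, labelVec η₂ j) +
      ∑ i, (noise (edgeProb δ p η₁ η₂) G *ᵥ 1) i) := by
    simp only [biadj_eq (edgeProb δ p η₁ η₂), edgeProb_eq, Finset.sum_add_distrib, ← Finset.mul_sum,
      mulVec, dotProduct, Pi.one_apply, mul_one, Finset.sum_mul_sum]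
    simp
    ring
  rw [pHat, h]
  field_simp
  ring

/-- The scalar bookkeeping for `formBound_perturbation`: g = γ₁ γ₂, N = √n₁, σ = √T, and h bounds
the noise part of D = p̂ - p. The final constants collect 4 + 4 from the two bias terms, 4 + 4 + 4
from the terms linear in the noise, and 4 + 4 from the quadratic ones. -/
theorem perturbation_budget {s D g h N σ T n₁ n₂ ρ₁ ρ₂ M t : ℝ} (hN0 : 0 < N) (hN₂ : 0 < n₂)
    (hNN : N * N = n₁) (hσ0 : 0 ≤ σ) (hσσ : σ * σ = T) (hg0 : 0 ≤ g) (hg1 : g ≤ 1)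
    (hhN : h * (N * n₂) = σ) (hρ₁ : ρ₁ ≤ σ) (hρ₂ : ρ₂ ≤ σ) (hM : |M| ≤ n₂)
    (hD : |D| ≤ |s| * g + h) (hρ₂0 : 0 ≤ ρ₂) :
    t + |s| * (4 * (N * ρ₁)) + |-(D * s * M)| * (4 * n₁) + |-D| * (4 * (N * ρ₂)) +
        |D ^ 2 * n₂ / 2| * (4 * n₁) ≤
      t + 8 * g * (s ^ 2 * n₁ * n₂) + 12 * |s| * (N * σ) + 8 * T / n₂ := by
  have hs0 := abs_nonneg s
  have hss : s ^ 2 = |s| * |s| := by rw [← sq, sq_abs]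
  have hDn : 0 ≤ |D| := abs_nonneg D
  have hN₁ : 0 < n₁ := by rw [← hNN]; positivity
  have hh : h = σ / (N * n₂) := by rw [← hhN]; field_simp
  have hh0 : 0 ≤ h := by rw [hh]; positivity
  have hh3 : h * (n₁ * n₂) = N * σ := by rw [← hhN, ← hNN]; ring
  have hσN : h * N * σ = T / n₂ := by
    rw [← hσσ, hh]; field_simp
  have hhh : h * h * (n₁ * n₂) = T / n₂ := by rw [mul_assoc, hh3, ← hσN]; ring
  have e1 : |s| * (4 * (N * ρ₁)) ≤ 4 * |s| * (N * σ) := by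
    have := mul_le_mul_of_nonneg_left hρ₁ (mul_nonneg hs0 hN0.le)
    linarith
  have e2 : |-(D * s * M)| * (4 * n₁) ≤ 4 * g * (s ^ 2 * n₁ * n₂) + 4 * |s| * (N * σ) := by
    rw [abs_neg, abs_mul, abs_mul]
    have k1 : |D| * |s| * |M| ≤ (|s| * g + h) * |s| * n₂ :=
      mul_le_mul (mul_le_mul_of_nonneg_right hD hs0) hM (abs_nonneg _) (by positivity)
    have k2 := mul_le_mul_of_nonneg_right k1 (by positivity : (0 : ℝ) ≤ 4 * n₁)
    refine k2.trans_eq ?_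
    rw [hss, ← hh3]; ring
  have e3 : |-D| * (4 * (N * ρ₂)) ≤ 4 * |s| * (N * σ) + 4 * (T / n₂) := by
    rw [abs_neg]
    have k0 : |s| * g + h ≤ |s| + h := by nlinarith
    have k1 : |D| * (4 * (N * ρ₂)) ≤ (|s| + h) * (4 * (N * σ)) :=
      mul_le_mul (hD.trans k0)
        (mul_le_mul_of_nonneg_left (mul_le_mul_of_nonneg_left hρ₂ hN0.le) (by norm_num))
        (by positivity) (by positivity)
    refine k1.trans_eq ?_
    rw [← hσN]; ring
  have e4 : |D ^ 2 * n₂ / 2| * (4 * n₁) ≤ 4 * g * (s ^ 2 * n₁ * n₂) + 4 * (T / n₂) := by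
    have k0 : 0 ≤ D ^ 2 * n₂ / 2 := by positivity
    rw [abs_of_nonneg k0]
    have k1 : D ^ 2 ≤ 2 * (s ^ 2 * g) + 2 * (h * h) := by
      have k2 : D ^ 2 ≤ (|s| * g + h) ^ 2 := by
        rw [← sq_abs D]; exact pow_le_pow_left₀ hDn hD 2
      have k3 : (|s| * g) ^ 2 ≤ s ^ 2 * g := by
        rw [mul_pow, sq_abs]
        exact mul_le_mul_of_nonneg_left (by nlinarith) (sq_nonneg _)
      linarith [sq_nonneg (|s| * g - h)]
    have k2 := mul_le_mul_of_nonneg_right k1 (by positivity : (0 : ℝ) ≤ 2 * (n₁ * n₂))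
    rw [← hhh]
    linarith
  have e5 : 8 * T / n₂ = 4 * (T / n₂) + 4 * (T / n₂) := by ring
  rw [e5]
  linarith

theorem formBound_perturbation (h₁ : 0 < n₁) (h₂ : 0 < n₂) {δ p γ₁ γ₂ t T : ℝ}
    {η₁ : Labels n₁} {η₂ : Labels n₂} {G : BipGraph n₁ n₂}
    (hη₁ : imbalance η₁ ≤ γ₁) (hη₂ : imbalance η₂ ≤ γ₂) (hγ₁ : γ₁ ∈ Set.Ioo (0 : ℝ) 1)
    (hγ₂ : γ₂ ∈ Set.Ioo (0 : ℝ) 1)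
    (ht : FormBound (noiseGram (edgeProb δ p η₁ η₂) G) t)
    (hT : (noise (edgeProb δ p η₁ η₂) G *ᵥ labelVec η₂) ⬝ᵥ
        (noise (edgeProb δ p η₁ η₂) G *ᵥ labelVec η₂) +
      (noise (edgeProb δ p η₁ η₂) G *ᵥ 1) ⬝ᵥ (noise (edgeProb δ p η₁ η₂) G *ᵥ 1) ≤ T) :
    FormBound (perturbation (edgeProb δ p η₁ η₂) η₁ η₂ ((δ - 1) * p) (pHat (biadj G) - p) G)
      (t + 8 * (γ₁ * γ₂) * (((δ - 1) * p) ^ 2 * n₁ * n₂) +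
        12 * |(δ - 1) * p| * Real.sqrt (n₁ * T) + 8 * T / n₂) := by
  set W := noise (edgeProb δ p η₁ η₂) G with hW
  have hDeq := pHat_biadj_sub h₁ h₂ δ p η₁ η₂ G
  rw [← hW] at hDeq
  set s := (δ - 1) * p with hs
  set D := pHat (biadj G) - p with hD
  set R := W *ᵥ labelVec η₂ with hR
  set r := W *ᵥ (1 : Fin n₂ → ℝ) with hr
  set M₁ := ∑ i, labelVec η₁ i with hM₁
  set M₂ := ∑ j, labelVec η₂ j with hM₂
  have hN₁ : (0 : ℝ) < n₁ := by exact_mod_cast h₁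
  have hN₂ : (0 : ℝ) < n₂ := by exact_mod_cast h₂
  have hM₁' := abs_sum_labelVec_le h₁ hη₁
  have hM₂' := abs_sum_labelVec_le h₂ hη₂
  rw [← hM₁] at hM₁'
  rw [← hM₂] at hM₂'
  obtain ⟨a₁, b₁⟩ := hγ₁
  obtain ⟨a₂, b₂⟩ := hγ₂
  set g := γ₁ * γ₂ with hg
  have hg0 : 0 < g := by positivity
  have hg1 : g ≤ 1 := mul_le_one₀ b₁.le a₂.le b₂.le
  set N := Real.sqrt n₁ with hNdef
  have hN0 : 0 < N := Real.sqrt_pos.2 hN₁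
  have hNN : N * N = n₁ := Real.mul_self_sqrt hN₁.le
  have hone : Real.sqrt ((1 : Fin n₁ → ℝ) ⬝ᵥ 1) = N := by
    rw [dotProduct_self_eq]; simp [hNdef]
  have hlab : Real.sqrt (labelVec η₁ ⬝ᵥ labelVec η₁) = N := by rw [labelVec_dotProduct_self]
  set σ := Real.sqrt T with hσ
  have hσ0 : 0 ≤ σ := Real.sqrt_nonneg _
  have hRR : 0 ≤ R ⬝ᵥ R := by rw [dotProduct_self_eq]; positivity
  have hrr : 0 ≤ r ⬝ᵥ r := by rw [dotProduct_self_eq]; positivity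
  have hT0 : 0 ≤ T := by linarith
  have hσσ : σ * σ = T := Real.mul_self_sqrt hT0
  have hRσ : Real.sqrt (R ⬝ᵥ R) ≤ σ := Real.sqrt_le_sqrt (by linarith)
  have hrσ : Real.sqrt (r ⬝ᵥ r) ≤ σ := Real.sqrt_le_sqrt (by linarith)
  set h := σ / (N * n₂) with hh
  have hh0 : 0 ≤ h := by positivity
  have hhN : h * (N * n₂) = σ := by rw [hh]; field_simp
  have hDle : |D| ≤ |s| * g + h := by
    have hsum : |∑ i, r i| ≤ N * σ := by
      have := abs_dotProduct_le_sqrt (1 : Fin n₁ → ℝ) r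
      rw [hone] at this
      simp only [dotProduct, Pi.one_apply, one_mul] at this
      exact this.trans (mul_le_mul_of_nonneg_left hrσ hN0.le)
    rw [hDeq, abs_div, abs_of_pos (mul_pos hN₁ hN₂), div_le_iff₀ (mul_pos hN₁ hN₂)]
    refine (abs_add_le _ _).trans ?_
    rw [abs_mul s, abs_mul M₁]
    have h1 : |M₁| * |M₂| ≤ (γ₁ * n₁) * (γ₂ * n₂) :=
      mul_le_mul hM₁' hM₂' (abs_nonneg _) (by positivity)
    have h2 := mul_le_mul_of_nonneg_left h1 (abs_nonneg s)
    have h3 : h * (n₁ * n₂) = N * σ := by rw [← hhN, ← hNN]; ring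
    rw [add_mul, h3]
    refine add_le_add (h2.trans_eq ?_) hsum
    rw [hg]; ring
  refine ((((ht.add ((formBound_hollowSym _ _).smul _)).add
    ((formBound_hollowSym _ _).smul _)).add ((formBound_hollowSym _ _).smul _)).add
    ((formBound_hollowSym _ _).smul _)).mono ?_
  rw [hone, hlab, hNN, Real.sqrt_mul hN₁.le T]
  exact perturbation_budget hN0 hN₂ hNN hσ0 hσσ hg0.le hg1 hhN hRσ hrσ
    (hM₂'.trans (mul_le_of_le_one_left hN₂.le b₂.le)) hDle (Real.sqrt_nonneg _)

end Decomposition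

/-! ### Second moments of the noise; the model law as a finite sum -/

section Moments

variable {n₁ n₂ : ℕ}

theorem prodExp_berCentered_sq {I : Type*} [Fintype I] [DecidableEq I] (q : I → ℝ) (x : I) :
    prodExp (fun i => berWeight (q i)) (fun c => berCentered (q x) (c x) ^ 2) =
      ∑ b, berWeight (q x) b * berCentered (q x) b ^ 2 := by
  have h := prodExp_prod (fun i => berWeight (q i))
    (fun z b => if z = x then berCentered (q z) b ^ 2 else 1)
  simp only [Finset.prod_ite_eq', Finset.mem_univ, if_true] at h
  rw [h, Finset.prod_eq_single x]
  · simp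
  · intro z _ hz
    simp only [hz, if_false, mul_one, sum_berWeight]
  · simp

theorem prodExp_noise_mulVec_sq_le {q : Fin n₁ × Fin n₂ → ℝ} {p : ℝ} (h0 : ∀ x, 0 ≤ q x)
    (hp : ∀ x, q x ≤ 2 * p) {b : Fin n₂ → ℝ} (hb : ∀ j, b j ^ 2 = 1) :
    prodExp (fun x => berWeight (q x)) (fun G => (noise q G *ᵥ b) ⬝ᵥ (noise q G *ᵥ b)) ≤
      2 * p * n₁ * n₂ := by
  have e : ∀ G : Fin n₁ × Fin n₂ → Bool, (noise q G *ᵥ b) ⬝ᵥ (noise q G *ᵥ b) =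
      ∑ i, ∑ j, ∑ k, (b j * b k) *
        (berCentered (q (i, j)) (G (i, j)) * berCentered (q (i, k)) (G (i, k))) := by
    intro G
    rw [dotProduct]
    refine Finset.sum_congr rfl fun i _ => ?_
    rw [mulVec, dotProduct, Finset.sum_mul_sum]
    refine Finset.sum_congr rfl fun j _ => Finset.sum_congr rfl fun k _ => ?_
    simp only [noise, of_apply]
    ring
  simp only [e, prodExp_sum, prodExp_const_mul]
  calc _ ≤ ∑ i : Fin n₁, ∑ j : Fin n₂, ∑ k : Fin n₂, (if j = k then 2 * p else 0) := by
        refine Finset.sum_le_sum fun i _ => Finset.sum_le_sum fun j _ =>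
          Finset.sum_le_sum fun k _ => ?_
        split_ifs with hjk
        · subst hjk
          simp only [← sq]
          rw [hb, one_mul, prodExp_berCentered_sq]
          exact sum_berWeight_mul_sq_le (h0 _) (hp _)
        · rw [prodExp_berCentered_mul, mul_zero]
          simpa using hjk
    _ = _ := by
        simp
        ring

theorem edgeProb_mem {δ p : ℝ} (hδ : δ ∈ Set.Ioo (0 : ℝ) 2) (hp : p ∈ Set.Ioo (0 : ℝ) (1 / 2))
    (η₁ : Labels n₁) (η₂ : Labels n₂) (x : Fin n₁ × Fin n₂) :
    0 ≤ edgeProb δ p η₁ η₂ x ∧ edgeProb δ p η₁ η₂ x ≤ 1 ∧ edgeProb δ p η₁ η₂ x ≤ 2 * p := by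
  obtain ⟨h1, h2⟩ := hδ
  obtain ⟨h3, h4⟩ := hp
  unfold edgeProb
  split_ifs
  · refine ⟨by positivity, ?_, ?_⟩ <;> nlinarith
  · have : 0 < 2 - δ := by linarith
    refine ⟨by positivity, ?_, ?_⟩ <;> nlinarith

theorem ber_singleton {q : ℝ} (h0 : 0 ≤ q) (h1 : q ≤ 1) (b : Bool) :
    ber q {b} = ENNReal.ofReal (berWeight q b) := by
  classical
  rw [ber, bernoulliMeasure_apply _ (MeasurableSet.singleton b), Set.projIcc_of_mem _ ⟨h0, h1⟩]
  cases b
  · have : unitInterval.toNNReal (unitInterval.symm ⟨q, h0, h1⟩) = Real.toNNReal (1 - q) := by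
      ext; simp [h1]
    simp [berWeight, ENNReal.ofReal, this]
  · have : unitInterval.toNNReal ⟨q, h0, h1⟩ = Real.toNNReal q := by
      ext; simp [h0]
    simp [berWeight, ENNReal.ofReal, this]

/-- The graph space is finite, so the measure of an event is the sum of its singleton weights; all
estimates can then be made on finite real sums. -/
theorem law_eq_ofReal_prodProb {δ p : ℝ} (hδ : δ ∈ Set.Ioo (0 : ℝ) 2)
    (hp : p ∈ Set.Ioo (0 : ℝ) (1 / 2)) (η₁ : Labels n₁) (η₂ : Labels n₂)
    (P : BipGraph n₁ n₂ → Prop) :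
    law δ p η₁ η₂ {G | P G} =
      ENNReal.ofReal (prodProb (fun x => berWeight (edgeProb δ p η₁ η₂ x)) P) := by
  classical
  have hq := fun x => edgeProb_mem hδ hp η₁ η₂ x
  have hw : ∀ x b, 0 ≤ berWeight (edgeProb δ p η₁ η₂ x) b :=
    fun x b => berWeight_nonneg (hq x).1 (hq x).2.1 b
  have hsing : ∀ G : BipGraph n₁ n₂, law δ p η₁ η₂ {G} =
      ENNReal.ofReal (∏ x, berWeight (edgeProb δ p η₁ η₂ x) (G x)) := by
    intro G
    have : ∀ x : Fin n₁ × Fin n₂, IsProbabilityMeasure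
        (ber (if η₁ x.1 = η₂ x.2 then δ * p else (2 - δ) * p)) := fun x => by
      unfold ber; infer_instance
    rw [law, Measure.pi_singleton, ENNReal.ofReal_prod_of_nonneg fun x _ => hw x _]
    exact Finset.prod_congr rfl fun x _ => ber_singleton (hq x).1 (hq x).2.1 _
  have hset : {G | P G} = ((Finset.univ.filter P : Finset (BipGraph n₁ n₂)) : Set _) := by
    ext; simp
  rw [hset, ← MeasureTheory.sum_measure_singleton]
  simp only [hsing]
  rw [← ENNReal.ofReal_sum_of_nonneg fun G _ => Finset.prod_nonneg fun x _ => hw x _]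
  congr 1
  rw [prodProb, prodExp, Finset.sum_filter]
  exact Finset.sum_congr rfl fun G _ => by split_ifs <;> simp

end Moments

/-! ### Choice of parameters and conclusion -/

/-- The constant in the spectral norm bound of the hollowed noise Gram matrix. -/
noncomputable def noiseConst : ℝ := 252 * Real.exp 6 + 2

theorem one_le_noiseConst : 1 ≤ noiseConst := by
  have := Real.exp_pos 6
  unfold noiseConst
  linarith

theorem prodProb_not_formBound_noiseGram_le_two_div {n₁ n₂ : ℕ} (h₁ : 2 ≤ n₁) (h₂ : 2 ≤ n₂)
    {q : Fin n₁ × Fin n₂ → ℝ} {p : ℝ} (h0 : ∀ x, 0 ≤ q x) (h1 : ∀ x, q x ≤ 1)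
    (hq : ∀ x, q x ≤ 2 * p) (hp : rate n₁ n₂ ≤ p) :
    prodProb (fun x => berWeight (q x))
      (fun G => ¬ FormBound (noiseGram q G) (noiseConst * (p * n₁ * n₂ * rate n₁ n₂))) ≤
      2 / n₁ := by
  have hN₁ : (0 : ℝ) < n₁ := by positivity
  have hN₂ : (0 : ℝ) < n₂ := by positivity
  set L := Real.log n₁ with hL
  have hL0 : 0 < L := Real.log_pos (by exact_mod_cast h₁)
  set ρ := rate n₁ n₂ with hρ
  have hρ1 : L / n₂ ≤ ρ := le_max_right _ _
  have hρ2 : Real.sqrt (L / (n₁ * n₂)) ≤ ρ := le_max_left _ _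
  have hρ0 : 0 < ρ := lt_of_lt_of_le (by positivity) hρ1
  have hp0 : 0 < p := hρ0.trans_le hp
  have hLρ : L ≤ ρ * n₂ := by rwa [div_le_iff₀ hN₂] at hρ1
  have hLρ2 : L ≤ ρ ^ 2 * (n₁ * n₂) := by
    have := Real.sqrt_le_left hρ0.le |>.1 hρ2
    rwa [div_le_iff₀ (by positivity)] at this
  set τ := p * n₁ * n₂ * ρ with hτ
  have hτ0 : 0 < τ := by positivity
  have hLτ : L ≤ τ := by
    refine hLρ2.trans ?_
    have := mul_le_mul_of_nonneg_right hp (by positivity : 0 ≤ ρ * (n₁ * n₂))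
    rw [hτ]; linarith
  have hθτ : L / τ * τ = L := div_mul_cancel₀ _ hτ0.ne'
  -- With θ = L/τ, the branch L ≤ ρ n₂ of the rate gives θ p n₁ ≤ 1. The branch L ≤ ρ² n₁ n₂ gives
  -- θ² p² n₁ n₂ ≤ L and, with ρ ≤ p, also θ ≤ 1.
  refine (prodProb_not_formBound_noiseGram_le (θ := L / τ) h0 h1 hq hp0.le (by positivity)
    ((div_le_one hτ0).2 hLτ) ?_).trans ?_
  · rw [Fintype.card_fin, mul_assoc, div_mul_eq_mul_div, div_le_one hτ0, hτ]
    have := mul_le_mul_of_nonneg_right hLρ (by positivity : 0 ≤ p * n₁)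
    linarith
  · rw [Fintype.card_fin]
    have hvar : (L / τ) ^ 2 * p ^ 2 * n₁ * n₂ ≤ L := by
      have e : (L / τ) ^ 2 * p ^ 2 * n₁ * n₂ = L * (L / (ρ ^ 2 * (n₁ * n₂))) := by
        rw [hτ]; field_simp
      rw [e]
      exact mul_le_of_le_one_right hL0.le ((div_le_one (by positivity)).2 hLρ2)
    -- The extra 2 in `noiseConst` leaves exp(-2 L) = n₁⁻², which beats the dimensional factor 2 n₁.
    have hexp : 252 * Real.exp 6 * (L / τ) ^ 2 * p ^ 2 * n₁ * n₂ - L / τ * (noiseConst * τ) ≤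
        -(L + L) := by
      have k1 : L / τ * (noiseConst * τ) = noiseConst * L := by
        rw [mul_left_comm, hθτ]
      have k2 := mul_le_mul_of_nonneg_left hvar (by positivity : 0 ≤ 252 * Real.exp 6)
      rw [k1, noiseConst]
      linarith
    refine (mul_le_mul_of_nonneg_left (Real.exp_le_exp.2 hexp) (by positivity)).trans_eq ?_
    rw [Real.exp_neg, Real.exp_add, hL, Real.exp_log hN₁]
    field_simp

theorem worstCaseFailure_le {n₁ n₂ : ℕ} (h₁ : 2 ≤ n₁) (h₂ : 2 ≤ n₂) {δ p γ₁ γ₂ α C : ℝ}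
    (hδ : δ ∈ Set.Ioo (0 : ℝ) 2) (hδ1 : δ ≠ 1) (hp : p ∈ Set.Ioo (0 : ℝ) (1 / 2))
    (hγ₁ : γ₁ ∈ Set.Ioo (0 : ℝ) 1) (hγ₂ : γ₂ ∈ Set.Ioo (0 : ℝ) 1) (hα : α ∈ Set.Ioo (0 : ℝ) 1)
    {e : Estimator n₁ n₂} (he : IsSpectralEstimator e)
    (hC : 12 * noiseConst / Real.sqrt α ≤ C) (hγ : γ₁ * γ₂ ≤ Real.sqrt α / 96)
    (hpC : C * ((δ - 1) ^ 2)⁻¹ * rate n₁ n₂ ≤ p)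
    (hsmall : 24 * Real.sqrt (Real.sqrt (Real.log n₁))⁻¹ + 32 * (Real.sqrt (Real.log n₁))⁻¹ ≤
      Real.sqrt α / 12) :
    worstCaseFailure δ p γ₁ γ₂ α e ≤
      ENNReal.ofReal (2 / n₁ + (Real.sqrt (Real.log n₁))⁻¹) := by
  have hN₁ : (0 : ℝ) < n₁ := by positivity
  have hN₂ : (0 : ℝ) < n₂ := by positivity
  have hn₁ : 0 < n₁ := by omega
  have hn₂ : 0 < n₂ := by omega
  set L := Real.log n₁ with hL
  have hL0 : 0 < L := Real.log_pos (by exact_mod_cast h₁)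
  set ρ := rate n₁ n₂ with hρ
  have hρ1 : L / n₂ ≤ ρ := le_max_right _ _
  have hρ0 : 0 < ρ := lt_of_lt_of_le (by positivity) hρ1
  have hLρ : L ≤ ρ * n₂ := by rwa [div_le_iff₀ hN₂] at hρ1
  have hα0 : 0 < Real.sqrt α := Real.sqrt_pos.2 hα.1
  have hα1 : Real.sqrt α ≤ 1 := Real.sqrt_le_one.2 hα.2.le
  have hK := one_le_noiseConst
  rw [div_le_iff₀ hα0] at hC
  have hC1 : 1 ≤ C := by
    by_contra hc
    push Not at hc
    have : C * Real.sqrt α < 12 := by nlinarith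
    linarith
  have hd0 : 0 < (δ - 1) ^ 2 := by
    have : δ - 1 ≠ 0 := sub_ne_zero.2 hδ1
    positivity
  have hd1 : (δ - 1) ^ 2 ≤ 1 := by nlinarith [hδ.1, hδ.2]
  have hCρ : C * ρ ≤ (δ - 1) ^ 2 * p := by
    have := mul_le_mul_of_nonneg_left hpC hd0.le
    rwa [show (δ - 1) ^ 2 * (C * ((δ - 1) ^ 2)⁻¹ * ρ) = C * ρ by field_simp] at this
  have hp0 := hp.1
  have hρd : ρ ≤ (δ - 1) ^ 2 * p := (le_mul_of_one_le_left hρ0.le hC1).trans hCρ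
  have hρp : ρ ≤ p := hρd.trans (mul_le_of_le_one_left hp0.le hd1)
  set s := (δ - 1) * p with hs
  have hs2 : s ^ 2 = (δ - 1) ^ 2 * p * p := by rw [hs]; ring
  have hs2pos : 0 < s ^ 2 := by rw [hs2]; positivity
  set y := (Real.sqrt L)⁻¹ with hy
  have hsL : 0 < Real.sqrt L := Real.sqrt_pos.2 hL0
  have hy0 : 0 < y := inv_pos.2 hsL
  have hyL : y * L = Real.sqrt L := by
    rw [hy]; nth_rewrite 2 [← Real.mul_self_sqrt hL0.le]; field_simp
  -- The two squared noise vectors have total mean at most 4 p n₁ n₂. The extra √L makes the Markov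
  -- failure probability y = 1/√L, while L ≤ (δ - 1)² p n₂ keeps the resulting terms negligible
  -- against l n₁.
  set T := 4 * p * n₁ * n₂ * Real.sqrt L with hT
  have hT0 : 0 < T := by positivity
  set l := s ^ 2 * n₂ with hl
  have hl0 : 0 < l := by positivity
  set t := noiseConst * (p * n₁ * n₂ * ρ) with ht
  have htle : t ≤ Real.sqrt α / 12 * (l * n₁) := by
    have k1 : noiseConst * ρ ≤ Real.sqrt α / 12 * (C * ρ) := by nlinarith
    have k2 : noiseConst * ρ ≤ Real.sqrt α / 12 * ((δ - 1) ^ 2 * p) :=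
      k1.trans (mul_le_mul_of_nonneg_left hCρ (by positivity))
    have k3 := mul_le_mul_of_nonneg_right k2 (by positivity : 0 ≤ p * n₁ * n₂)
    rw [ht, hl, hs2]
    linarith
  have hTle : T ≤ 4 * n₁ * n₂ * (y * l) := by
    have k1 : L ≤ (δ - 1) ^ 2 * p * n₂ := hLρ.trans (mul_le_mul_of_nonneg_right hρd hN₂.le)
    have k2 := mul_le_mul_of_nonneg_left k1 (by positivity : 0 ≤ 4 * n₁ * n₂ * (y * p))
    rw [hT, hl, hs2, ← hyL]
    linarith
  have hsqrt : |s| * Real.sqrt (n₁ * T) ≤ 2 * Real.sqrt y * (l * n₁) := by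
    have k1 : (n₁ : ℝ) * T ≤ (2 * n₁ * n₂ * |s|) ^ 2 * y := by
      have := mul_le_mul_of_nonneg_left hTle hN₁.le
      rw [mul_pow, sq_abs]
      rw [hl] at this
      linarith
    have k2 := Real.sqrt_le_sqrt k1
    rw [Real.sqrt_mul (sq_nonneg _), Real.sqrt_sq (by positivity)] at k2
    have k3 := mul_le_mul_of_nonneg_left k2 (abs_nonneg s)
    refine k3.trans_eq ?_
    rw [hl, ← sq_abs s]; ring
  have hTn : 8 * T / n₂ ≤ 32 * y * (l * n₁) := by
    rw [div_le_iff₀ hN₂]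
    linarith
  refine iSup_le fun η₁ => iSup_le fun η₂ => iSup_le fun hη₁ => iSup_le fun hη₂ => ?_
  rw [law_eq_ofReal_prodProb hδ hp]
  refine ENNReal.ofReal_le_ofReal ?_
  set q := edgeProb δ p η₁ η₂ with hq
  have hqm := fun x => edgeProb_mem hδ hp η₁ η₂ x
  rw [← hq] at hqm
  have hw : ∀ x b, 0 ≤ berWeight (q x) b := fun x b => berWeight_nonneg (hqm x).1 (hqm x).2.1 b
  set F : BipGraph n₁ n₂ → ℝ := fun G =>
    (noise q G *ᵥ labelVec η₂) ⬝ᵥ (noise q G *ᵥ labelVec η₂) +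
      (noise q G *ᵥ 1) ⬝ᵥ (noise q G *ᵥ 1) with hF
  have hF0 : ∀ G, 0 ≤ F G := fun G => by
    rw [hF]; simp only [dotProduct_self_eq]; positivity
  have himp : ∀ G, α ≤ loss η₁ (e G) / n₁ → (¬ FormBound (noiseGram q G) t ∨ T ≤ F G) := by
    intro G hG
    by_contra hc
    push Not at hc
    obtain ⟨hc1, hc2⟩ := hc
    obtain ⟨v, hv, hsign⟩ := he G
    rw [hollowedGram_eq δ p η₁ η₂ G] at hv
    have hε := formBound_perturbation hn₁ hn₂ hη₁ hη₂ hγ₁ hγ₂ hc1 hc2.le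
    have hlt := loss_lt_of_formBound hn₁ (perturbation_isSymm _ _ _ _ _ _) hv hsign hε hl0 hα ?_
    · rw [le_div_iff₀ hN₁] at hG
      linarith
    -- The noise takes √α/12 by `htle`, the bias 8 · √α/96 = √α/12, and the remaining terms (24 √y +
    -- 32 y) ≤ √α/12, in total √α/4.
    · have k1 := mul_le_mul_of_nonneg_right hγ (by positivity : 0 ≤ l * n₁)
      have k2 := mul_le_mul_of_nonneg_right hsmall (by positivity : 0 ≤ l * n₁)
      have k3 : s ^ 2 * n₁ * n₂ = l * n₁ := by rw [hl]; ring
      rw [← hs, k3]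
      linarith
  refine (prodProb_mono hw himp).trans ((prodProb_or_le hw _ _).trans (add_le_add ?_ ?_))
  · exact prodProb_not_formBound_noiseGram_le_two_div h₁ h₂ (fun x => (hqm x).1)
      (fun x => (hqm x).2.1) (fun x => (hqm x).2.2) hρp
  · refine (prodProb_le_div hw hF0 hT0).trans ?_
    have m1 := prodExp_noise_mulVec_sq_le (fun x => (hqm x).1) (fun x => (hqm x).2.2)
      (b := labelVec η₂) fun j => labelVal_sq _
    have m2 := prodExp_noise_mulVec_sq_le (fun x => (hqm x).1) (fun x => (hqm x).2.2)
      (b := (1 : Fin n₂ → ℝ)) fun j => by simp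
    rw [hF, prodExp_add, div_le_iff₀ hT0]
    have k1 : y * T = 4 * p * n₁ * n₂ := by rw [hT, hy]; field_simp
    rw [k1]
    linarith

/-- Hypotheses are needed only eventually, so both parts follow: in the almost full regime the
diverging constants pass the thresholds of each fixed α from some index on. -/
theorem weakRecoveryAt_of_eventually {α : ℝ} (hα : α ∈ Set.Ioo (0 : ℝ) 1) {n₁ n₂ : ℕ → ℕ}
    {δ p γ₁ γ₂ : ℕ → ℝ} {e : ∀ k, Estimator (n₁ k) (n₂ k)}
    (hm : IsModelSequence n₁ n₂ δ p γ₁ γ₂) (he : ∀ k, IsSpectralEstimator (e k))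
    (hγ : ∀ᶠ k in atTop, γ₁ k * γ₂ k ≤ Real.sqrt α / 96)
    (hp : ∀ᶠ k in atTop, 12 * noiseConst / Real.sqrt α * ((δ k - 1) ^ 2)⁻¹ * rate (n₁ k) (n₂ k) ≤
      p k) :
    WeakRecoveryAt α n₁ n₂ δ p γ₁ γ₂ e := by
  have hcast : Tendsto (fun k => (n₁ k : ℝ)) atTop atTop :=
    tendsto_natCast_atTop_atTop.comp hm.n₁_tendsto
  have hy : Tendsto (fun k => (Real.sqrt (Real.log (n₁ k)))⁻¹) atTop (𝓝 0) :=
    tendsto_inv_atTop_zero.comp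
      (Real.tendsto_sqrt_atTop.comp (Real.tendsto_log_atTop.comp hcast))
  have hsmall : ∀ᶠ k in atTop, 24 * Real.sqrt (Real.sqrt (Real.log (n₁ k)))⁻¹ +
      32 * (Real.sqrt (Real.log (n₁ k)))⁻¹ ≤ Real.sqrt α / 12 := by
    have h : Tendsto (fun k => 24 * Real.sqrt (Real.sqrt (Real.log (n₁ k)))⁻¹ +
        32 * (Real.sqrt (Real.log (n₁ k)))⁻¹) atTop (𝓝 0) := by
      simpa using (hy.sqrt.const_mul 24).add (hy.const_mul 32)
    have hα0 : 0 < Real.sqrt α / 12 := by have := Real.sqrt_pos.2 hα.1; positivity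
    exact (h.eventually_lt_const hα0).mono fun k hk => hk.le
  have hbound : Tendsto (fun k => ENNReal.ofReal (2 / n₁ k + (Real.sqrt (Real.log (n₁ k)))⁻¹))
      atTop (𝓝 0) := by
    have h : Tendsto (fun k => 2 / (n₁ k : ℝ) + (Real.sqrt (Real.log (n₁ k)))⁻¹) atTop (𝓝 0) := by
      simpa using (tendsto_const_nhds.div_atTop hcast (a := (2 : ℝ))).add hy
    simpa using ENNReal.tendsto_ofReal h
  refine tendsto_of_tendsto_of_tendsto_of_le_of_le' tendsto_const_nhds hbound
    (Eventually.of_forall fun _ => zero_le) ?_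
  filter_upwards [hγ, hp, hsmall] with k h1 h2 h3
  exact worstCaseFailure_le (hm.two_le_n₁ k) (hm.two_le_n₂ k) (hm.δ_mem k) (hm.δ_ne_one k)
    (hm.p_mem k) (hm.γ₁_mem k) (hm.γ₂_mem k) hα (he k) le_rfl h1 h2 h3

theorem mul_inv_sq_mul_rate_le {c C δ p : ℝ} {n₁ n₂ : ℕ} (hc : c ≤ C)
    (h : C * ((δ - 1) ^ 2)⁻¹ * rate n₁ n₂ ≤ p) : c * ((δ - 1) ^ 2)⁻¹ * rate n₁ n₂ ≤ p := by
  have hr : 0 ≤ rate n₁ n₂ := (Real.sqrt_nonneg _).trans (le_max_left _ _)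
  refine le_trans ?_ h
  gcongr

end BSBM

theorem theorem1 :
    (∃ C₀ : ℝ, 0 < C₀ ∧
      ∀ (α : ℝ), α ∈ Set.Ioo (0 : ℝ) 1 →
      ∀ (C : ℝ), C₀ / Real.sqrt α < C →
      ∀ (n₁ n₂ : ℕ → ℕ) (δ p γ₁ γ₂ : ℕ → ℝ) (e : ∀ k, BSBM.Estimator (n₁ k) (n₂ k)),
        BSBM.IsModelSequence n₁ n₂ δ p γ₁ γ₂ →
        (∀ k, BSBM.IsSpectralEstimator (e k)) →
        (∀ k, γ₁ k * γ₂ k ≤ Real.sqrt α / 96) →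
        (∀ k, C * ((δ k - 1) ^ 2)⁻¹ * BSBM.rate (n₁ k) (n₂ k) ≤ p k) →
        BSBM.WeakRecoveryAt α n₁ n₂ δ p γ₁ γ₂ e) ∧
    (∀ (C C' : ℕ → ℝ), (∀ n, 0 < C n) → (∀ n, 0 < C' n) →
      Tendsto C atTop atTop → Tendsto C' atTop atTop →
      ∀ (n₁ n₂ : ℕ → ℕ) (δ p γ₁ γ₂ : ℕ → ℝ) (e : ∀ k, BSBM.Estimator (n₁ k) (n₂ k)),
        BSBM.IsModelSequence n₁ n₂ δ p γ₁ γ₂ →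
        (∀ k, BSBM.IsSpectralEstimator (e k)) →
        (∀ k, γ₁ k * γ₂ k ≤ 1 / C' (n₁ k)) →
        (∀ k, C (n₁ k) * ((δ k - 1) ^ 2)⁻¹ * BSBM.rate (n₁ k) (n₂ k) ≤ p k) →
        BSBM.AlmostFullRecovery n₁ n₂ δ p γ₁ γ₂ e) := by
  refine ⟨⟨12 * BSBM.noiseConst, by linarith [BSBM.one_le_noiseConst], ?_⟩, ?_⟩
  · intro α hα C hC n₁ n₂ δ p γ₁ γ₂ e hm he hγ hp
    exact BSBM.weakRecoveryAt_of_eventually hα hm he (Eventually.of_forall hγ)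
      (Eventually.of_forall fun k => BSBM.mul_inv_sq_mul_rate_le hC.le (hp k))
  · intro C C' _ _ hC hC' n₁ n₂ δ p γ₁ γ₂ e hm he hγ hp α hα
    have hα0 : 0 < Real.sqrt α := Real.sqrt_pos.2 hα.1
    refine BSBM.weakRecoveryAt_of_eventually hα hm he ?_ ?_
    · filter_upwards [(hC'.comp hm.n₁_tendsto).eventually_ge_atTop (96 / Real.sqrt α)] with k hk
      refine (hγ k).trans ((one_div_le_one_div_of_le (by positivity) hk).trans_eq ?_)
      rw [one_div_div]
    · filter_upwards [(hC.comp hm.n₁_tendsto).eventually_ge_atTop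
        (12 * BSBM.noiseConst / Real.sqrt α)] with k hk
      exact BSBM.mul_inv_sq_mul_rate_le hk (hp k)
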